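/- A growth function is a continuous nondecreasing map $\Phi$ of $[0,\infty)$ onto itself. For $p\ge 1$, let $\mathscr U^p$ be the set of convex growth functions $\Phi$, of class $C^1$ on $(0,\infty)$, such that $\Phi(t)/t$ is nondecreasing on $(0,\infty)$ and, for some $C>0$, $\Phi(st)\le C t^p\Phi(s)$ for all $t\ge 1$, $s>0$. For $0<p\le 1$, let $\mathscr L_p$ be the set of concave growth functions $\Phi$, of class $C^1$ on $(0,\infty)$, such that $\Phi(t)/t$ is nonincreasing on $(0,\infty)$ and, for some $C>0$, $\Phi(st)\le C t^p\Phi(s)$ for all $0<t\le 1$, $s>0$. Put $\mathscr U=\bigcup_{p\ge1}\mathscr U^p$ and $\mathscr L=\bigcup_{0<p\le1}\mathscr L_p$; the members of $\mathscr L\cup\mathscr U$ are homeomorphisms of $[0,\infty)$. Let $\widetilde{\mathscr U}$ (resp. $\widetilde{\mathscr L}$) be the set of all $\Phi$ that, for some $q\ge1$ (resp. some $0<p\le 1$), belong to $\mathscr U^q$ (resp. $\mathscr L_p$) and satisfy, for some constants $C_1,C_2>0$, $\Phi(st)\le C_1\Phi(s)\Phi(t)$ for all $s,t>0$ and $$\Phi\left(\tfrac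 st\right)\le C_2\frac{\Phi(s)}{t^{q}}\quad\Big(\text{resp. }\ \Phi\left(\tfrac st\right)\le C_2\frac{s^{p}}{\Phi(t)}\Big)\qquad\text{for all } s,t\ge 1 .$$ Put $a_\Phi=\inf_{t>0}\frac{t\Phi'(t)}{\Phi(t)}$ and $b_\Phi=\sup_{t>0}\frac{t\Phi'(t)}{\Phi(t)}$. Let $\mathbb C_+$ be the upper half-plane. For $\alpha>-1$, $A^{\Phi}_\alpha(\mathbb C_+)$ is the set of analytic functions $F$ on $\mathbb C_+$ with $$\|F\|_{A^\Phi_\alpha}=\inf\Big\{\lambda>0:\int_{\mathbb C_+}\Phi\Big(\frac{|F(x+iy)|}{\lambda}\Big)y^\alpha\,dx\,dy\le 1\Big\}<\infty .$$ An analytic function $G$ on $\mathbb C_+$ is a multiplier from $A^{\Phi_1}_\alpha(\mathbb C_+)$ to $A^{\Phi_2}_\beta(\mathbb C_+)$ if there is $C>0$ such that, for all $F\in A^{\Phi_1}_\alpha(\mathbb C_+)$, $FG\in A^{\Phi_2}_\beta(\mathbb C_+)$ and $\|FG\|_{A^{\Phi_2}_\beta}\le C\|F\|_{A^{\Phi_1}_\alpha}$;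 let $\mathcal M(A^{\Phi_1}_\alpha,A^{\Phi_2}_\beta)$ be the set of these multipliers. For $\omega:(0,\infty)\to(0,\infty)$, $H^\infty_\omega(\mathbb C_+)$ is the set of analytic functions $F$ on $\mathbb C_+$ with $\sup_{z\in\mathbb C_+}|F(z)|/\omega(\operatorname{Im}z)<\infty$, and $H^\infty(\mathbb C_+)$ is the set of bounded analytic functions on $\mathbb C_+$. **Theorem.** Let $\Phi_1\in\mathscr L\cup\mathscr U$ and $\Phi_2\in\widetilde{\mathscr L}\cup\widetilde{\mathscr U}$ be such that $t\mapsto\Phi_2(t)/\Phi_1(t)$ is nondecreasing on $(0,\infty)$. Let $\alpha,\beta>-1$ and $$\omega(t)=\frac{\Phi_2^{-1}\left(t^{-2-\beta}\right)}{\Phi_1^{-1}\left(t^{-2-\alpha}\right)},\qquad t>0 .$$ 1. If $0<a_{\Phi_1}\le b_{\Phi_1}<a_{\Phi_2}\le b_{\Phi_2}<\infty$, then $\mathcal M(A^{\Phi_1}_\alpha,A^{\Phi_2}_\beta)=H^\infty_\omega(\mathbb C_+)$. 2. If $\omega\approx 1$, that is, $c^{-1}\le\omega(t)\le c$ for some $c>0$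 and all $t>0$, then $\mathcal M(A^{\Phi_1}_\alpha,A^{\Phi_2}_\beta)=H^\infty(\mathbb C_+)$. 3. If $\lim_{t\to0^+}\omega(t)=0$ (in particular, if $\omega(t)$ decreases to $0$ as $t\downarrow 0$), then $\mathcal M(A^{\Phi_1}_\alpha,A^{\Phi_2}_\beta)=\{0\}$. -/

import Mathlib

open Set Filter Topology MeasureTheory
open scoped UpperHalfPlane Manifold ENNReal

noncomputable section

namespace BergmanOrlicz

/-- A growth function: a continuous nondecreasing map of `[0, ∞)` onto itself.  It is represented
by a map `ℝ → ℝ`, of which only the values on `[0, ∞)` are ever used. -/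
structure IsGrowth (Φ : ℝ → ℝ) : Prop where
  continuousOn : ContinuousOn Φ (Ici 0)
  monotoneOn : MonotoneOn Φ (Ici 0)
  image_eq : Φ '' Ici 0 = Ici 0

/-- `Φ` is of upper type `p`. -/
def UpperType (p : ℝ) (Φ : ℝ → ℝ) : Prop :=
  ∃ C : ℝ, 0 < C ∧ ∀ t : ℝ, 1 ≤ t → ∀ s : ℝ, 0 < s → Φ (s * t) ≤ C * t ^ p * Φ s

/-- `Φ` is of lower type `p`. -/
def LowerType (p : ℝ) (Φ : ℝ → ℝ) : Prop :=
  ∃ C : ℝ, 0 < C ∧ ∀ t : ℝ, 0 < t → t ≤ 1 → ∀ s : ℝ, 0 < s → Φ (s * t) ≤ C * t ^ p * Φ s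

/-- The class `𝒰^p`, `p ≥ 1`; its members are, by convention, convex and continuously
differentiable on `(0, ∞)`. -/
structure ClassUp (p : ℝ) (Φ : ℝ → ℝ) : Prop where
  growth : IsGrowth Φ
  one_le : 1 ≤ p
  upperType : UpperType p Φ
  div_mono : MonotoneOn (fun t => Φ t / t) (Ioi 0)
  contDiffOn : ContDiffOn ℝ 1 Φ (Ioi 0)
  convexOn : ConvexOn ℝ (Ici 0) Φ

/-- The class `ℒ_p`, `0 < p ≤ 1`; its members are, by convention, concave and continuously
differentiable on `(0, ∞)`. (At `0` the derivative may be infinite, as for `t ↦ t ^ p`.) -/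
structure ClassLow (p : ℝ) (Φ : ℝ → ℝ) : Prop where
  growth : IsGrowth Φ
  pos : 0 < p
  le_one : p ≤ 1
  lowerType : LowerType p Φ
  div_anti : AntitoneOn (fun t => Φ t / t) (Ioi 0)
  contDiffOn : ContDiffOn ℝ 1 Φ (Ioi 0)
  concaveOn : ConcaveOn ℝ (Ici 0) Φ

/-- `Φ ∈ ℒ ∪ 𝒰`. -/
def MemLU (Φ : ℝ → ℝ) : Prop :=
  (∃ p, ClassLow p Φ) ∨ (∃ p, ClassUp p Φ)

/-- `Φ (s t) ≤ C Φ (s) Φ (t)` for all `s, t > 0`. -/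
def SubMult (Φ : ℝ → ℝ) : Prop :=
  ∃ C : ℝ, 0 < C ∧ ∀ s t : ℝ, 0 < s → 0 < t → Φ (s * t) ≤ C * (Φ s * Φ t)

/-- The class `𝒰̃^q`. -/
structure ClassUpTilde (q : ℝ) (Φ : ℝ → ℝ) : Prop where
  mem : ClassUp q Φ
  subMult : SubMult Φ
  div_le : ∃ C : ℝ, 0 < C ∧ ∀ s t : ℝ, 1 ≤ s → 1 ≤ t → Φ (s / t) ≤ C * (Φ s / t ^ q)

/-- The class `ℒ̃_p`. -/
structure ClassLowTilde (p : ℝ) (Φ : ℝ → ℝ) : Prop where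
  mem : ClassLow p Φ
  subMult : SubMult Φ
  div_le : ∃ C : ℝ, 0 < C ∧ ∀ s t : ℝ, 1 ≤ s → 1 ≤ t → Φ (s / t) ≤ C * (s ^ p / Φ t)

/-- `Φ ∈ ℒ̃ ∪ 𝒰̃`. -/
def MemLUTilde (Φ : ℝ → ℝ) : Prop :=
  (∃ p, ClassLowTilde p Φ) ∨ (∃ q, ClassUpTilde q Φ)

/-- The lower index `a_Φ = inf_{t > 0} t Φ'(t) / Φ(t)`. -/
def lowerIndex (Φ : ℝ → ℝ) : EReal :=
  ⨅ t : Ioi (0 : ℝ), (((t : ℝ) * deriv Φ t / Φ t : ℝ) : EReal)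

/-- The upper index `b_Φ = sup_{t > 0} t Φ'(t) / Φ(t)`. -/
def upperIndex (Φ : ℝ → ℝ) : EReal :=
  ⨆ t : Ioi (0 : ℝ), (((t : ℝ) * deriv Φ t / Φ t : ℝ) : EReal)

/-- The inverse of `Φ` as a map of `[0, ∞)` onto itself. -/
def growthInv (Φ : ℝ → ℝ) : ℝ → ℝ :=
  Function.invFunOn Φ (Ici 0)

/-- The measure `dV_α (x + i y) = y ^ α dx dy` on the upper half-plane (here `volume` is the
Lebesgue measure of `ℂ`). -/
def weightedArea (α : ℝ) : Measure ℍ :=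
  ((volume : Measure ℂ).comap UpperHalfPlane.coe).withDensity
    fun z => ENNReal.ofReal (z.im ^ α)

/-- The analytic functions on the upper half-plane. -/
def Analytic (F : ℍ → ℂ) : Prop :=
  MDifferentiable 𝓘(ℂ) 𝓘(ℂ) F

/-- The Luxemburg gauge
`‖F‖ = inf {l > 0 : ∫ Φ (|F| / l) dV_α ≤ 1}`, equal to `∞` if there is no such `l`. -/
def luxNorm (Φ : ℝ → ℝ) (α : ℝ) (F : ℍ → ℂ) : ℝ≥0∞ :=
  ⨅ (l : ℝ) (_ : 0 < l ∧ ∫⁻ z, ENNReal.ofReal (Φ (‖F z‖ / l)) ∂(weightedArea α) ≤ 1),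
    ENNReal.ofReal l

/-- The Bergman-Orlicz space `A_α^Φ(ℂ₊)`. -/
def bergmanOrlicz (Φ : ℝ → ℝ) (α : ℝ) : Set (ℍ → ℂ) :=
  {F | Analytic F ∧ luxNorm Φ α F < ∞}

/-- The pointwise multipliers from `A_α^{Φ₁}(ℂ₊)` to `A_β^{Φ₂}(ℂ₊)`. -/
def multipliers (Φ₁ : ℝ → ℝ) (α : ℝ) (Φ₂ : ℝ → ℝ) (β : ℝ) : Set (ℍ → ℂ) :=
  {G | Analytic G ∧ ∃ C : ℝ, 0 < C ∧ ∀ F ∈ bergmanOrlicz Φ₁ α,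
    F * G ∈ bergmanOrlicz Φ₂ β ∧ luxNorm Φ₂ β (F * G) ≤ ENNReal.ofReal C * luxNorm Φ₁ α F}

/-- The space `H^∞_ω(ℂ₊)`: analytic functions with `sup_z |F z| / ω (Im z) < ∞`. -/
def weightedHInfty (ω : ℝ → ℝ) : Set (ℍ → ℂ) :=
  {F | Analytic F ∧ BddAbove (range fun z : ℍ => ‖F z‖ / ω z.im)}

/-- The space `H^∞(ℂ₊)` of bounded analytic functions. -/
def hInfty : Set (ℍ → ℂ) :=
  {F | Analytic F ∧ BddAbove (range fun z : ℍ => ‖F z‖)}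

/-- `ω(t) = Φ₂⁻¹(1 / t^(2+β)) / Φ₁⁻¹(1 / t^(2+α))`. -/
def multWeight (Φ₁ : ℝ → ℝ) (α : ℝ) (Φ₂ : ℝ → ℝ) (β : ℝ) (t : ℝ) : ℝ :=
  growthInv Φ₂ (1 / t ^ (2 + β)) / growthInv Φ₁ (1 / t ^ (2 + α))

end BergmanOrlicz

end

/-!
Growth functions of positive lower and finite upper type behave like powers up to constants. By the
mean value inequality, functions of modular at most `1` in `A_α^Φ(ℂ₊)` are bounded at height `y` by
a multiple of `Φ⁻¹(y^{-2-α})`, and a power of the Cauchy kernel `y / (w - z̄)` shows that this is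
sharp. Testing a multiplier `G` on these kernels gives `|G| ≲ ω(Im ·)`. When `ω → 0` at the
boundary, the three lines theorem in the strip `l < Im < 2 Im z - l` gives
`|G z|² ≲ ω(l) ω(2 Im z - l)`, and `l → 0` forces `G = 0`.

Conversely, the pointwise bound on `F` means that `y^β Φ₂(|F G| / L) ≤ y^α Φ₁(|F|)` has to be
checked only for `|F| ≲ u := Φ₁⁻¹(y^{-2-α})`. With `v := Φ₂⁻¹(y^{-2-β})` one has
`y^β Φ₂(v) = y^α Φ₁(u) = y^{-2}`, and the inequality follows by descending from this case: through
a power `t^a` with `b_{Φ₁} < a < a_{Φ₂}` in the first part, and through the monotonicity of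
`Φ₂ / Φ₁` in the second.
-/

namespace BergmanOrlicz

/-! ### Growth functions -/

/-- Growth functions of some positive lower type and of some finite upper type. Up to multiplicative
constants they behave like powers; both `ℒ` and `𝒰` consist of such functions. -/
structure IsModerateGrowth (Φ : ℝ → ℝ) : Prop extends IsGrowth Φ where
  lowerType : ∃ p : ℝ, 0 < p ∧ LowerType p Φ
  upperType : ∃ q : ℝ, UpperType q Φ

section Growth

variable {Φ : ℝ → ℝ}

namespace IsGrowth

theorem nonneg (h : IsGrowth Φ) {x : ℝ} (hx : 0 ≤ x) : 0 ≤ Φ x :=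
  h.image_eq.subset (mem_image_of_mem Φ hx)

theorem map_le_map (h : IsGrowth Φ) {x y : ℝ} (hx : 0 ≤ x) (hxy : x ≤ y) : Φ x ≤ Φ y :=
  h.monotoneOn hx (hx.trans hxy) hxy

theorem exists_map_eq (h : IsGrowth Φ) {y : ℝ} (hy : 0 ≤ y) : ∃ x ∈ Ici (0 : ℝ), Φ x = y :=
  h.image_eq.superset hy

theorem map_zero (h : IsGrowth Φ) : Φ 0 = 0 := by
  obtain ⟨x, hx, hx0⟩ := h.exists_map_eq le_rfl
  exact ((h.map_le_map le_rfl hx).trans_eq hx0).antisymm (h.nonneg le_rfl)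

theorem growthInv_nonneg (h : IsGrowth Φ) {y : ℝ} (hy : 0 ≤ y) : 0 ≤ growthInv Φ y :=
  Function.invFunOn_mem (h.exists_map_eq hy)

theorem map_growthInv (h : IsGrowth Φ) {y : ℝ} (hy : 0 ≤ y) : Φ (growthInv Φ y) = y :=
  Function.invFunOn_eq (h.exists_map_eq hy)

theorem growthInv_pos (h : IsGrowth Φ) {y : ℝ} (hy : 0 < y) : 0 < growthInv Φ y := by
  refine (h.growthInv_nonneg hy.le).lt_of_ne fun h0 => hy.ne ?_
  rw [← h.map_growthInv hy.le, ← h0, h.map_zero]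

theorem monotoneOn_growthInv (h : IsGrowth Φ) : MonotoneOn (growthInv Φ) (Ici 0) := by
  intro x hx y hy hxy
  by_contra! hlt
  have hle := h.map_le_map (h.growthInv_nonneg hy) hlt.le
  rw [h.map_growthInv hx, h.map_growthInv hy] at hle
  exact hlt.ne (by rw [hxy.antisymm hle])

theorem exists_map_mul_le_of_upperType (h : IsGrowth Φ) {q : ℝ} (hq : UpperType q Φ) {K : ℝ}
    (hK : 0 < K) : ∃ D : ℝ, 0 < D ∧ ∀ x, 0 ≤ x → Φ (K * x) ≤ D * Φ x := by
  obtain ⟨C, hC, hup⟩ := hq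
  refine ⟨C * max 1 K ^ q, by positivity, fun x hx => ?_⟩
  rcases hx.eq_or_lt with rfl | hx
  · simp only [mul_zero, h.map_zero, le_refl]
  calc Φ (K * x) ≤ Φ (x * max 1 K) := by
        refine h.map_le_map (by positivity) ?_
        rw [mul_comm]
        gcongr
        exact le_max_right _ _
    _ ≤ C * max 1 K ^ q * Φ x := hup _ (le_max_left _ _) x hx

theorem exists_map_mul_le_of_lowerType (h : IsGrowth Φ) {p : ℝ} (hp : 0 < p)
    (hlow : LowerType p Φ) {ε : ℝ} (hε : 0 < ε) :
    ∃ δ ∈ Ioc (0 : ℝ) 1, ∀ x, 0 ≤ x → Φ (δ * x) ≤ ε * Φ x := by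
  obtain ⟨C, hC, hlow⟩ := hlow
  set δ := min 1 ((ε / C) ^ p⁻¹)
  have hδ : 0 < δ := by positivity
  have hδp : δ ^ p ≤ ε / C := by
    calc δ ^ p ≤ ((ε / C) ^ p⁻¹) ^ p := by gcongr; exact min_le_right _ _
      _ = ε / C := Real.rpow_inv_rpow (by positivity) hp.ne'
  refine ⟨δ, ⟨hδ, min_le_left _ _⟩, fun x hx => ?_⟩
  rcases hx.eq_or_lt with rfl | hx
  · simp only [mul_zero, h.map_zero, le_refl]
  have hΦx := h.nonneg hx.le
  calc Φ (δ * x) = Φ (x * δ) := by rw [mul_comm]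
    _ ≤ C * δ ^ p * Φ x := hlow δ hδ (min_le_left _ _) x hx
    _ ≤ C * (ε / C) * Φ x := by gcongr
    _ = ε * Φ x := by rw [mul_div_cancel₀ _ hC.ne']

theorem exists_map_mul_pow_le (h : IsGrowth Φ) {p : ℝ} (hp : 0 < p) (hlow : LowerType p Φ) {ε : ℝ}
    (hε : 0 < ε) (s : ℝ) :
    ∃ δ : ℝ, 0 < δ ∧ ∃ N : ℕ, ∀ {u τ : ℝ}, 0 < u → τ ∈ Ioc (0 : ℝ) 1 →
      Φ (δ * (u * τ ^ N)) ≤ ε * τ ^ s * Φ u := by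
  obtain ⟨C, hC, hle⟩ := id hlow
  obtain ⟨δ, ⟨hδ, -⟩, hshrink⟩ := h.exists_map_mul_le_of_lowerType hp hlow (div_pos hε hC)
  obtain ⟨N, hN⟩ := exists_nat_ge (s / p)
  rw [div_le_iff₀ hp] at hN
  refine ⟨δ, hδ, N, fun {u τ} hu ⟨hτ, hτ1⟩ => ?_⟩
  have hΦu := h.nonneg hu.le
  calc Φ (δ * (u * τ ^ N)) ≤ ε / C * Φ (u * τ ^ N) := hshrink _ (by positivity)
    _ ≤ ε / C * (C * (τ ^ N) ^ p * Φ u) := by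
        gcongr
        exact hle _ (by positivity) (pow_le_one₀ hτ.le hτ1) _ hu
    _ = ε * τ ^ (N * p) * Φ u := by
        rw [Real.rpow_natCast_mul hτ.le]
        field_simp
    _ ≤ ε * τ ^ s * Φ u := by
        have := Real.rpow_le_rpow_of_exponent_ge hτ hτ1 hN
        gcongr

theorem pos_of_upperType (h : IsGrowth Φ) {q : ℝ} (hq : UpperType q Φ) {x : ℝ} (hx : 0 < x) :
    0 < Φ x := by
  refine (h.nonneg hx.le).lt_of_ne' fun hΦx => ?_
  obtain ⟨y, hy, hΦy⟩ := h.exists_map_eq zero_le_one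
  obtain ⟨C, -, hup⟩ := hq
  have hle : Φ y ≤ Φ (x * max 1 (y / x)) := by
    refine h.map_le_map hy ?_
    calc y = x * (y / x) := (mul_div_cancel₀ _ hx.ne').symm
      _ ≤ x * max 1 (y / x) := by gcongr; exact le_max_right _ _
  have hzero := hle.trans (hup _ (le_max_left _ _) x hx)
  rw [hΦx, hΦy, mul_zero] at hzero
  exact zero_lt_one.not_ge hzero

end IsGrowth

namespace IsModerateGrowth

theorem pos (h : IsModerateGrowth Φ) {x : ℝ} (hx : 0 < x) : 0 < Φ x :=
  let ⟨_, hq⟩ := h.upperType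
  h.pos_of_upperType hq hx

theorem exists_map_mul_le (h : IsModerateGrowth Φ) {K : ℝ} (hK : 0 < K) :
    ∃ D : ℝ, 0 < D ∧ ∀ x, 0 ≤ x → Φ (K * x) ≤ D * Φ x :=
  let ⟨_, hq⟩ := h.upperType
  h.exists_map_mul_le_of_upperType hq hK

theorem exists_map_mul_le_mul (h : IsModerateGrowth Φ) {ε : ℝ} (hε : 0 < ε) :
    ∃ δ ∈ Ioc (0 : ℝ) 1, ∀ x, 0 ≤ x → Φ (δ * x) ≤ ε * Φ x :=
  let ⟨_, hp, hlow⟩ := h.lowerType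
  h.exists_map_mul_le_of_lowerType hp hlow hε

theorem exists_le_mul_of_map_le (h : IsModerateGrowth Φ) {K : ℝ} (hK : 0 < K) :
    ∃ D : ℝ, 0 < D ∧ ∀ x y, 0 ≤ x → 0 ≤ y → Φ x ≤ K * Φ y → x ≤ D * y := by
  obtain ⟨δ, ⟨hδ, -⟩, hshrink⟩ := h.exists_map_mul_le_mul (ε := (2 * K)⁻¹) (by positivity)
  refine ⟨δ⁻¹, by positivity, fun x y hx hy hxy => ?_⟩
  by_contra! hlt
  have hx0 : 0 < x := hlt.trans_le' (by positivity)
  have hyx : y ≤ δ * x := ((inv_mul_lt_iff₀ hδ).1 hlt).le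
  have hhalf : Φ x ≤ Φ x / 2 := by
    calc Φ x ≤ K * Φ y := hxy
      _ ≤ K * ((2 * K)⁻¹ * Φ x) := by gcongr; exact (h.map_le_map hy hyx).trans (hshrink x hx)
      _ = Φ x / 2 := by field_simp
  linarith [h.pos hx0]

end IsModerateGrowth

theorem upperType_one_of_antitoneOn_div (h : AntitoneOn (fun t => Φ t / t) (Ioi 0)) :
    UpperType 1 Φ := by
  refine ⟨1, one_pos, fun t ht s hs => ?_⟩
  have hst : 0 < s * t := mul_pos hs (one_pos.trans_le ht)
  have hle : Φ (s * t) / (s * t) ≤ Φ s / s := h hs hst (le_mul_of_one_le_right hs.le ht)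
  rw [div_le_iff₀ hst] at hle
  calc Φ (s * t) ≤ Φ s / s * (s * t) := hle
    _ = 1 * t ^ (1 : ℝ) * Φ s := by rw [Real.rpow_one]; field_simp

theorem lowerType_one_of_monotoneOn_div (h : MonotoneOn (fun t => Φ t / t) (Ioi 0)) :
    LowerType 1 Φ := by
  refine ⟨1, one_pos, fun t ht ht1 s hs => ?_⟩
  have hst : 0 < s * t := mul_pos hs ht
  have hle : Φ (s * t) / (s * t) ≤ Φ s / s := h hst hs (mul_le_of_le_one_right hs.le ht1)
  rw [div_le_iff₀ hst] at hle
  calc Φ (s * t) ≤ Φ s / s * (s * t) := hle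
    _ = 1 * t ^ (1 : ℝ) * Φ s := by rw [Real.rpow_one]; field_simp

theorem MemLU.isModerateGrowth (h : MemLU Φ) : IsModerateGrowth Φ := by
  rcases h with ⟨p, h⟩ | ⟨q, h⟩
  · exact ⟨h.growth, ⟨p, h.pos, h.lowerType⟩, 1, upperType_one_of_antitoneOn_div h.div_anti⟩
  · exact ⟨h.growth, ⟨1, one_pos, lowerType_one_of_monotoneOn_div h.div_mono⟩, q, h.upperType⟩

theorem MemLU.differentiableOn (h : MemLU Φ) : DifferentiableOn ℝ Φ (Ioi 0) := by
  rcases h with ⟨_, h⟩ | ⟨_, h⟩ <;> exact h.contDiffOn.differentiableOn one_ne_zero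

theorem MemLUTilde.memLU (h : MemLUTilde Φ) : MemLU Φ :=
  h.imp (Exists.imp fun _ h => h.mem) (Exists.imp fun _ h => h.mem)

end Growth

section Index

variable {Φ : ℝ → ℝ} {a : ℝ}

theorem hasDerivAt_div_rpow (hd : DifferentiableOn ℝ Φ (Ioi 0)) {t : ℝ} (ht : 0 < t)
    (hΦt : 0 < Φ t) :
    HasDerivAt (fun t => Φ t / t ^ a) (Φ t / t ^ (a + 1) * (t * deriv Φ t / Φ t - a)) t := by
  have hΦ : HasDerivAt Φ (deriv Φ t) t :=
    ((hd t ht).differentiableAt (Ioi_mem_nhds ht)).hasDerivAt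
  have hpow : HasDerivAt (fun t : ℝ => t ^ a) (a * t ^ (a - 1)) t :=
    Real.hasDerivAt_rpow_const (Or.inl ht.ne')
  refine (hΦ.div hpow (by positivity)).congr_deriv ?_
  rw [Real.rpow_sub_one ht.ne', Real.rpow_add_one ht.ne']
  field_simp

theorem monotoneOn_div_rpow_of_le_lowerIndex (hd : DifferentiableOn ℝ Φ (Ioi 0))
    (hpos : ∀ t, 0 < t → 0 < Φ t) (ha : a ≤ lowerIndex Φ) :
    MonotoneOn (fun t => Φ t / t ^ a) (Ioi 0) := by
  have hderiv (t : ℝ) (ht : 0 < t) := hasDerivAt_div_rpow (a := a) hd ht (hpos t ht)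
  refine monotoneOn_of_hasDerivWithinAt_nonneg (convex_Ioi 0)
    (fun t ht => (hderiv t ht).continuousAt.continuousWithinAt)
    (fun t ht => (hderiv t (interior_subset ht)).hasDerivWithinAt) fun t ht => ?_
  have ht : 0 < t := interior_subset ht
  have hquot : a ≤ t * deriv Φ t / Φ t :=
    EReal.coe_le_coe_iff.1 (ha.trans (iInf_le (fun t : Ioi (0 : ℝ) =>
      (((t : ℝ) * deriv Φ t / Φ t : ℝ) : EReal)) ⟨t, ht⟩))
  exact mul_nonneg (div_nonneg (hpos t ht).le (by positivity)) (sub_nonneg.2 hquot)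

theorem antitoneOn_div_rpow_of_upperIndex_le (hd : DifferentiableOn ℝ Φ (Ioi 0))
    (hpos : ∀ t, 0 < t → 0 < Φ t) (ha : upperIndex Φ ≤ a) :
    AntitoneOn (fun t => Φ t / t ^ a) (Ioi 0) := by
  have hderiv (t : ℝ) (ht : 0 < t) := hasDerivAt_div_rpow (a := a) hd ht (hpos t ht)
  refine antitoneOn_of_hasDerivWithinAt_nonpos (convex_Ioi 0)
    (fun t ht => (hderiv t ht).continuousAt.continuousWithinAt)
    (fun t ht => (hderiv t (interior_subset ht)).hasDerivWithinAt) fun t ht => ?_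
  have ht : 0 < t := interior_subset ht
  have hquot : t * deriv Φ t / Φ t ≤ a :=
    EReal.coe_le_coe_iff.1 ((le_iSup (fun t : Ioi (0 : ℝ) =>
      (((t : ℝ) * deriv Φ t / Φ t : ℝ) : EReal)) ⟨t, ht⟩).trans ha)
  exact mul_nonpos_of_nonneg_of_nonpos (div_nonneg (hpos t ht).le (by positivity))
    (sub_nonpos.2 hquot)

end Index

/-! ### A mean value inequality -/

section MeanValue

open Metric

theorem exists_ball_subset_forall_le_four_mul {X : Type*} [PseudoMetricSpace X] [ProperSpace X]
    {φ : X → ℝ} {z : X} {R : ℝ} (hR : 0 < R) (hφ : ContinuousOn φ (closedBall z R))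
    (hφ0 : ∀ w, 0 ≤ φ w) (hφz : 0 < φ z) :
    ∃ w ρ, 0 < ρ ∧ ball w ρ ⊆ ball z R ∧ R ^ 2 * φ z ≤ 4 * ρ ^ 2 * φ w ∧
      ∀ v ∈ ball w ρ, φ v ≤ 4 * φ w := by
  obtain ⟨w, hw, hmax⟩ := (isCompact_closedBall z R).exists_isMaxOn
    ⟨z, mem_closedBall_self hR.le⟩ (f := fun w => (R - dist w z) ^ 2 * φ w) (by fun_prop)
  have hzw : R ^ 2 * φ z ≤ (R - dist w z) ^ 2 * φ w := by
    simpa only [mem_ofPred_eq, dist_self, sub_zero] using hmax (mem_closedBall_self hR.le)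
  have hdist : dist w z < R := by
    refine (mem_closedBall.1 hw).lt_of_ne fun heq => ?_
    rw [heq, sub_self] at hzw
    have := mul_pos (pow_pos hR 2) hφz
    linarith
  have hsub : ball w ((R - dist w z) / 2) ⊆ ball z R := ball_subset_ball' (by linarith)
  refine ⟨w, (R - dist w z) / 2, by linarith, hsub, hzw.trans_eq (by ring), fun v hv => ?_⟩
  have hv2 : (R - dist w z) / 2 ≤ R - dist v z := by
    linarith [dist_triangle v w z, mem_ball.1 hv]
  have hle : ((R - dist w z) / 2) ^ 2 * φ v ≤ ((R - dist w z) / 2) ^ 2 * (4 * φ w) := by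
    calc ((R - dist w z) / 2) ^ 2 * φ v ≤ (R - dist v z) ^ 2 * φ v :=
          mul_le_mul_of_nonneg_right (pow_le_pow_left₀ (by linarith) hv2 2) (hφ0 v)
      _ ≤ (R - dist w z) ^ 2 * φ w := hmax (ball_subset_closedBall (hsub hv))
      _ = ((R - dist w z) / 2) ^ 2 * (4 * φ w) := by ring
  exact le_of_mul_le_mul_left hle (by nlinarith)

theorem half_norm_le_norm_of_norm_le_mul {E F : Type*} [NormedAddCommGroup E] [NormedSpace ℂ E]
    [NormedAddCommGroup F] [NormedSpace ℂ F] {f : E → F} {w v : E} {ρ M : ℝ} (hρ : 0 < ρ)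
    (hM : 0 < M) (hf : DifferentiableOn ℂ f (ball w ρ))
    (hle : ∀ v ∈ ball w ρ, ‖f v‖ ≤ M * ‖f w‖) (hv : v ∈ ball w (ρ / (2 * (M + 1)))) :
    ‖f w‖ / 2 ≤ ‖f v‖ := by
  have hmaps : MapsTo f (ball w ρ) (closedBall (f w) ((M + 1) * ‖f w‖)) := fun u hu => by
    rw [mem_closedBall, dist_eq_norm]
    linarith [norm_sub_le (f u) (f w), hle u hu]
  have hvρ : v ∈ ball w ρ := ball_subset_ball (div_le_self hρ.le (by linarith)) hv
  have hdist : dist (f v) (f w) ≤ ‖f w‖ / 2 := by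
    calc dist (f v) (f w) ≤ (M + 1) * ‖f w‖ / ρ * dist v w :=
          Complex.dist_le_div_mul_dist_of_mapsTo_ball hf hmaps hvρ
      _ ≤ (M + 1) * ‖f w‖ / ρ * (ρ / (2 * (M + 1))) := by gcongr; exact (mem_ball.1 hv).le
      _ = ‖f w‖ / 2 := by field_simp
  rw [dist_eq_norm'] at hdist
  linarith [norm_sub_norm_le (f w) (f v)]

theorem ofReal_mul_le_lintegral_ball {g : ℂ → ℝ} {w : ℂ} {r c : ℝ} (hr : 0 ≤ r)
    (hg : ∀ v ∈ ball w r, c ≤ g v) :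
    ENNReal.ofReal (Real.pi * r ^ 2 * c) ≤ ∫⁻ v in ball w r, ENNReal.ofReal (g v) := by
  have hvol : ENNReal.ofReal (Real.pi * r ^ 2) = volume (ball w r) := by
    rw [Complex.volume_ball, mul_comm Real.pi, ENNReal.ofReal_mul (by positivity),
      ENNReal.ofReal_pow hr, ← NNReal.coe_real_pi, ENNReal.ofReal_coe_nnreal]
  rw [ENNReal.ofReal_mul (by positivity), hvol, mul_comm, ← setLIntegral_const]
  exact setLIntegral_mono' measurableSet_ball fun v hv => ENNReal.ofReal_le_ofReal (hg v hv)

/-- `Φ ∘ ‖f‖` need not be subharmonic, so the centre is first replaced by a point `w` around which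
`Φ ∘ ‖f‖` is at most four times its value at `w`; by the Schwarz lemma it is then also bounded below
near `w`. -/
theorem IsModerateGrowth.exists_sq_mul_le_lintegral {Φ : ℝ → ℝ} (h : IsModerateGrowth Φ)
    {F : Type*} [NormedAddCommGroup F] [NormedSpace ℂ F] :
    ∃ K : ℝ, 0 < K ∧ ∀ (f : ℂ → F) (z : ℂ) (R : ℝ), 0 < R →
      DifferentiableOn ℂ f (closedBall z R) →
      ENNReal.ofReal (R ^ 2 * Φ ‖f z‖) ≤
        ENNReal.ofReal K * ∫⁻ w in ball z R, ENNReal.ofReal (Φ ‖f w‖) := by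
  obtain ⟨M, hM, hquot⟩ := h.exists_le_mul_of_map_le (K := 4) (by norm_num)
  obtain ⟨D, hD, hdbl⟩ := h.exists_map_mul_le (K := 2) two_pos
  set η := 1 / (2 * (M + 1)) with hη
  have hη0 : 0 < η := by positivity
  have hη1 : η ≤ 1 := by rw [hη, div_le_one (by positivity)]; linarith
  refine ⟨4 * D / (Real.pi * η ^ 2), by positivity, fun f z R hR hf => ?_⟩
  rcases (h.nonneg (norm_nonneg (f z))).eq_or_lt with hz0 | hz0
  · rw [← hz0, mul_zero, ENNReal.ofReal_zero]
    exact zero_le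
  obtain ⟨w, ρ, hρ, hsub, hRρ, hfour⟩ := exists_ball_subset_forall_le_four_mul
    (φ := fun w => Φ ‖f w‖) hR
    (h.continuousOn.comp hf.continuousOn.norm fun w _ => norm_nonneg _)
    (fun w => h.nonneg (norm_nonneg _)) hz0
  have hlower : ∀ v ∈ ball w (ρ * η), Φ ‖f w‖ / D ≤ Φ ‖f v‖ := fun v hv => by
    have hhalf : ‖f w‖ / 2 ≤ ‖f v‖ :=
      half_norm_le_norm_of_norm_le_mul hρ hM (hf.mono (hsub.trans ball_subset_closedBall))
        (fun u hu => hquot _ _ (norm_nonneg _) (norm_nonneg _) (hfour u hu))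
        (by rwa [hη, mul_one_div] at hv)
    rw [div_le_iff₀' hD]
    calc Φ ‖f w‖ ≤ Φ (2 * ‖f v‖) := h.map_le_map (norm_nonneg _) (by linarith)
      _ ≤ D * Φ ‖f v‖ := hdbl _ (norm_nonneg _)
  calc ENNReal.ofReal (R ^ 2 * Φ ‖f z‖)
      ≤ ENNReal.ofReal (4 * D / (Real.pi * η ^ 2) * (Real.pi * (ρ * η) ^ 2 * (Φ ‖f w‖ / D))) := by
        refine ENNReal.ofReal_le_ofReal (hRρ.trans_eq ?_)
        field_simp
    _ ≤ ENNReal.ofReal (4 * D / (Real.pi * η ^ 2)) *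
          ∫⁻ v in ball w (ρ * η), ENNReal.ofReal (Φ ‖f v‖) := by
        rw [ENNReal.ofReal_mul (by positivity)]
        gcongr
        exact ofReal_mul_le_lintegral_ball (by positivity) hlower
    _ ≤ ENNReal.ofReal (4 * D / (Real.pi * η ^ 2)) *
          ∫⁻ v in ball z R, ENNReal.ofReal (Φ ‖f v‖) := by
        refine mul_le_mul_right (lintegral_mono_set ?_) _
        exact (ball_subset_ball (mul_le_of_le_one_right hρ.le hη1)).trans hsub

end MeanValue

/-! ### The modular and the Luxemburg gauge -/

section Modular

open UpperHalfPlane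

variable {Φ Ψ : ℝ → ℝ} {α β : ℝ} {F G H : ℍ → ℂ}

theorem lintegral_weightedArea (α : ℝ) (g : ℍ → ℝ≥0∞) :
    ∫⁻ z, g z ∂weightedArea α =
      ∫⁻ z, ENNReal.ofReal (z.im ^ α) * g z ∂(volume : Measure ℂ).comap UpperHalfPlane.coe := by
  rw [weightedArea, lintegral_withDensity_eq_lintegral_mul_non_measurable]
  · rfl
  · exact (continuous_im.measurable.pow_const α).ennreal_ofReal
  · exact ae_of_all _ fun _ => ENNReal.ofReal_lt_top

theorem lintegral_weightedArea_eq_setLIntegral (α : ℝ) (g : ℍ → ℝ≥0∞) :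
    ∫⁻ z, g z ∂weightedArea α =
      ∫⁻ w in upperHalfPlaneSet, ENNReal.ofReal (w.im ^ α) * g (ofComplex w) := by
  rw [lintegral_weightedArea, ← range_coe, ← measurableEmbedding_coe.map_comap,
    measurableEmbedding_coe.lintegral_map]
  simp only [ofComplex_apply, coe_im]

/-- The modular `∫ Φ (|F|) dV_α` underlying the Luxemburg gauge. -/
noncomputable def modular (Φ : ℝ → ℝ) (α : ℝ) (F : ℍ → ℂ) : ℝ≥0∞ :=
  ∫⁻ z, ENNReal.ofReal (Φ ‖F z‖) ∂weightedArea α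

theorem modular_le_modular
    (h : ∀ z : ℍ, z.im ^ β * Ψ ‖H z‖ ≤ z.im ^ α * Φ ‖F z‖) : modular Ψ β H ≤ modular Φ α F := by
  rw [modular, modular, lintegral_weightedArea, lintegral_weightedArea]
  refine lintegral_mono fun z => ?_
  dsimp only
  rw [← ENNReal.ofReal_mul (Real.rpow_nonneg z.im_pos.le _),
    ← ENNReal.ofReal_mul (Real.rpow_nonneg z.im_pos.le _)]
  exact ENNReal.ofReal_le_ofReal (h z)

theorem modular_inv_smul {l : ℝ} (hl : 0 < l) :
    modular Φ α ((l : ℂ)⁻¹ • F) = ∫⁻ z, ENNReal.ofReal (Φ (‖F z‖ / l)) ∂weightedArea α := by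
  simp only [modular, Pi.smul_apply, norm_smul, norm_inv, Complex.norm_real,
    Real.norm_of_nonneg hl.le, inv_mul_eq_div]

theorem norm_inv_smul_mul_apply {l : ℝ} (hl : 0 < l) (z : ℍ) :
    ‖((l : ℂ)⁻¹ • (F * G)) z‖ = ‖F z‖ * ‖G z‖ / l := by
  rw [Pi.smul_apply, norm_smul, norm_inv, Complex.norm_real, Real.norm_of_nonneg hl.le,
    inv_mul_eq_div, Pi.mul_apply, norm_mul]

theorem luxNorm_le_ofReal {l : ℝ} (hl : 0 < l) (h : modular Φ α ((l : ℂ)⁻¹ • F) ≤ 1) :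
    luxNorm Φ α F ≤ ENNReal.ofReal l :=
  iInf₂_le l ⟨hl, (modular_inv_smul hl).ge.trans h⟩

theorem exists_modular_le_one_of_luxNorm_lt {c : ℝ≥0∞} (h : luxNorm Φ α F < c) :
    ∃ l : ℝ, 0 < l ∧ ENNReal.ofReal l < c ∧ modular Φ α ((l : ℂ)⁻¹ • F) ≤ 1 := by
  simp only [luxNorm, iInf_lt_iff] at h
  obtain ⟨l, ⟨hl, hle⟩, hlc⟩ := h
  exact ⟨l, hl, hlc, (modular_inv_smul hl).trans_le hle⟩

theorem Analytic.mul (hF : Analytic F) (hG : Analytic G) : Analytic (F * G) :=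
  MDifferentiable.mul hF hG

theorem Analytic.const_smul (hF : Analytic F) (c : ℂ) : Analytic (c • F) :=
  MDifferentiable.const_smul c hF

theorem Analytic.differentiableOn (hF : Analytic F) :
    DifferentiableOn ℂ (F ∘ ofComplex) upperHalfPlaneSet :=
  UpperHalfPlane.mdifferentiable_iff.1 hF

end Modular

/-! ### Point evaluations -/

section PointEvaluation

open Metric UpperHalfPlane

variable {Φ : ℝ → ℝ} {α : ℝ}

/-- The size, up to multiplicative constants, of the evaluation functionals of `A_α^Φ(ℂ₊)` at the
points of height `y`. -/
noncomputable def evalScale (Φ : ℝ → ℝ) (α y : ℝ) : ℝ :=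
  growthInv Φ (1 / y ^ (2 + α))

theorem multWeight_eq_div (Φ₁ : ℝ → ℝ) (α : ℝ) (Φ₂ : ℝ → ℝ) (β t : ℝ) :
    multWeight Φ₁ α Φ₂ β t = evalScale Φ₂ β t / evalScale Φ₁ α t :=
  rfl

theorem IsGrowth.evalScale_pos (h : IsGrowth Φ) (α : ℝ) {y : ℝ} (hy : 0 < y) :
    0 < evalScale Φ α y :=
  h.growthInv_pos (by positivity)

theorem IsGrowth.map_evalScale (h : IsGrowth Φ) (α : ℝ) {y : ℝ} (hy : 0 < y) :
    Φ (evalScale Φ α y) = 1 / y ^ (2 + α) :=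
  h.map_growthInv (by positivity)

theorem IsGrowth.rpow_mul_map_evalScale (h : IsGrowth Φ) (α : ℝ) {y : ℝ} (hy : 0 < y) :
    y ^ α * Φ (evalScale Φ α y) = 1 / y ^ 2 := by
  rw [h.map_evalScale α hy, Real.rpow_add hy, Real.rpow_two]
  field_simp

theorem rpow_le_two_rpow_abs_mul_rpow {s t : ℝ} (hs : 0 < s) (hst : s ≤ 2 * t) (hts : t ≤ 2 * s)
    (α : ℝ) : s ^ α ≤ 2 ^ |α| * t ^ α := by
  have ht : 0 < t := by linarith
  have hlog : |Real.log (s / t)| ≤ Real.log 2 := by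
    rw [abs_le, ← Real.log_inv]
    constructor
    · refine Real.log_le_log (by norm_num) ?_
      rw [le_div_iff₀ ht]
      linarith
    · exact Real.log_le_log (by positivity) ((div_le_iff₀ ht).2 hst)
  rw [← div_le_iff₀ (by positivity), ← Real.div_rpow hs.le ht.le,
    Real.rpow_def_of_pos (by positivity), Real.rpow_def_of_pos two_pos, Real.exp_le_exp]
  calc Real.log (s / t) * α ≤ |Real.log (s / t)| * |α| := by rw [← abs_mul]; exact le_abs_self _
    _ ≤ Real.log 2 * |α| := by gcongr

theorem im_mem_Icc_of_mem_closedBall {z w : ℂ} (hw : w ∈ closedBall z (z.im / 2)) :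
    w.im ∈ Icc (z.im / 2) (3 * z.im / 2) := by
  have him : |(w - z).im| ≤ z.im / 2 :=
    (Complex.abs_im_le_norm _).trans (mem_closedBall_iff_norm.1 hw)
  rw [Complex.sub_im, abs_le] at him
  constructor <;> linarith

theorem closedBall_subset_upperHalfPlaneSet (z : ℍ) :
    closedBall (z : ℂ) (z.im / 2) ⊆ upperHalfPlaneSet := fun _ hw =>
  (half_pos z.im_pos).trans_le (im_mem_Icc_of_mem_closedBall hw).1

theorem rpow_mul_setLIntegral_ball_le (α : ℝ) (g : ℍ → ℝ≥0∞) (z : ℍ) :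
    ENNReal.ofReal (z.im ^ α) * ∫⁻ w in ball (z : ℂ) (z.im / 2), g (ofComplex w) ≤
      ENNReal.ofReal (2 ^ |α|) * ∫⁻ w, g w ∂weightedArea α := by
  have hle : ∀ w ∈ ball (z : ℂ) (z.im / 2),
      ENNReal.ofReal (z.im ^ α) ≤ ENNReal.ofReal (2 ^ |α|) * ENNReal.ofReal (w.im ^ α) :=
    fun w hw => by
      obtain ⟨hlow, hupp⟩ := im_mem_Icc_of_mem_closedBall (ball_subset_closedBall hw)
      rw [coe_im] at hlow hupp
      rw [← ENNReal.ofReal_mul (by positivity)]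
      exact ENNReal.ofReal_le_ofReal
        (rpow_le_two_rpow_abs_mul_rpow z.im_pos (by linarith) (by linarith [z.im_pos]) α)
  rw [lintegral_weightedArea_eq_setLIntegral, ← lintegral_const_mul' _ _ ENNReal.ofReal_ne_top,
    ← lintegral_const_mul' _ _ ENNReal.ofReal_ne_top]
  refine (setLIntegral_mono' measurableSet_ball fun w hw => ?_).trans (lintegral_mono_set
    (ball_subset_closedBall.trans (closedBall_subset_upperHalfPlaneSet z)))
  rw [← mul_assoc]
  gcongr
  exact hle w hw

theorem IsModerateGrowth.exists_rpow_mul_map_norm_le_modular (h : IsModerateGrowth Φ) (α : ℝ) :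
    ∃ A : ℝ, 0 < A ∧ ∀ F : ℍ → ℂ, Analytic F → ∀ z : ℍ,
      ENNReal.ofReal (z.im ^ (2 + α) * Φ ‖F z‖) ≤ ENNReal.ofReal A * modular Φ α F := by
  obtain ⟨A, hA, hmean⟩ := h.exists_sq_mul_le_lintegral (F := ℂ)
  refine ⟨4 * A * 2 ^ |α|, by positivity, fun F hF z => ?_⟩
  have hy := z.im_pos
  have hball := hmean (F ∘ ofComplex) z (z.im / 2) (half_pos hy)
    (hF.differentiableOn.mono (closedBall_subset_upperHalfPlaneSet z))
  rw [Function.comp_apply, ofComplex_apply] at hball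
  calc ENNReal.ofReal (z.im ^ (2 + α) * Φ ‖F z‖)
      = ENNReal.ofReal 4 * (ENNReal.ofReal (z.im ^ α) *
          ENNReal.ofReal ((z.im / 2) ^ 2 * Φ ‖F z‖)) := by
        rw [← ENNReal.ofReal_mul (by positivity), ← ENNReal.ofReal_mul (by norm_num),
          Real.rpow_add hy, Real.rpow_two]
        ring_nf
    _ ≤ ENNReal.ofReal 4 * (ENNReal.ofReal (z.im ^ α) * (ENNReal.ofReal A *
          ∫⁻ w in ball (z : ℂ) (z.im / 2), ENNReal.ofReal (Φ ‖F (ofComplex w)‖))) := by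
        gcongr
        exact hball
    _ = ENNReal.ofReal (4 * A) * (ENNReal.ofReal (z.im ^ α) *
          ∫⁻ w in ball (z : ℂ) (z.im / 2), ENNReal.ofReal (Φ ‖F (ofComplex w)‖)) := by
        rw [ENNReal.ofReal_mul (by norm_num)]
        ring
    _ ≤ ENNReal.ofReal (4 * A) * (ENNReal.ofReal (2 ^ |α|) * modular Φ α F) :=
        mul_le_mul_right
          (rpow_mul_setLIntegral_ball_le α (fun w => ENNReal.ofReal (Φ ‖F w‖)) z) _
    _ = ENNReal.ofReal (4 * A * 2 ^ |α|) * modular Φ α F := by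
        rw [← mul_assoc, ← ENNReal.ofReal_mul (by positivity)]

theorem IsModerateGrowth.exists_norm_le_mul_evalScale (h : IsModerateGrowth Φ) (α : ℝ) :
    ∃ K : ℝ, 1 ≤ K ∧ ∀ F : ℍ → ℂ, Analytic F → modular Φ α F ≤ 1 →
      ∀ z : ℍ, ‖F z‖ ≤ K * evalScale Φ α z.im := by
  obtain ⟨A, hA, hpoint⟩ := h.exists_rpow_mul_map_norm_le_modular α
  obtain ⟨D, -, hquot⟩ := h.exists_le_mul_of_map_le hA
  refine ⟨max 1 D, le_max_left _ _, fun F hF hmod z => ?_⟩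
  have hy := z.im_pos
  have hscale := h.evalScale_pos α hy
  have hle : z.im ^ (2 + α) * Φ ‖F z‖ ≤ A :=
    (ENNReal.ofReal_le_ofReal_iff hA.le).1 ((hpoint F hF z).trans (mul_le_of_le_one_right' hmod))
  have hΦ : Φ ‖F z‖ ≤ A * Φ (evalScale Φ α z.im) := by
    rwa [h.map_evalScale α hy, mul_one_div, le_div_iff₀' (by positivity)]
  calc ‖F z‖ ≤ D * evalScale Φ α z.im := hquot _ _ (norm_nonneg _) hscale.le hΦ
    _ ≤ max 1 D * evalScale Φ α z.im := by gcongr; exact le_max_right _ _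

end PointEvaluation

/-! ### Test functions -/

section Integrals

variable {α y : ℝ}

theorem lintegral_div_sub_sq_add_sq (a : ℝ) {s : ℝ} (hs : 0 < s) :
    ∫⁻ x : ℝ, ENNReal.ofReal (s / ((x - a) ^ 2 + s ^ 2)) = ENNReal.ofReal Real.pi := by
  lift s to NNReal using hs.le
  have hpdf : ∀ x : ℝ, ENNReal.ofReal (s / ((x - a) ^ 2 + s ^ 2)) =
      ENNReal.ofReal Real.pi * ProbabilityTheory.cauchyPDF a s x := fun x => by
    rw [ProbabilityTheory.cauchyPDF_def, ← ENNReal.ofReal_mul Real.pi_pos.le,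
      ProbabilityTheory.cauchyPDFReal_def]
    congr 1
    field_simp
  simp_rw [hpdf]
  rw [lintegral_const_mul' _ _ ENNReal.ofReal_ne_top,
    ProbabilityTheory.lintegral_cauchyPDF_eq_one a (NNReal.coe_pos.1 hs).ne', mul_one]

theorem hasDerivAt_div_add_rpow {t : ℝ} (ht : 0 < t) (hy : 0 < y) (hα : α + 1 ≠ 0) :
    HasDerivAt (fun t => y ^ (α + 1) / (α + 1) * (t / (t + y)) ^ (α + 1))
      (t ^ α * (y / (t + y)) ^ (α + 2)) t := by
  have hty : 0 < t + y := by positivity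
  have hquot : HasDerivAt (fun t => t / (t + y)) ((1 * (t + y) - t * 1) / (t + y) ^ 2) t :=
    (hasDerivAt_id t).div ((hasDerivAt_id t).add_const y) hty.ne'
  refine ((hquot.rpow_const (p := α + 1) (Or.inl (by positivity))).const_mul _).congr_deriv ?_
  rw [add_sub_cancel_right, Real.div_rpow ht.le hty.le, Real.div_rpow hy.le hty.le,
    show α + 2 = α + 1 + 1 by ring, Real.rpow_add_one hy.ne' (α + 1),
    Real.rpow_add_one hty.ne' (α + 1), Real.rpow_add_one hty.ne' α]
  field_simp
  ring

theorem tendsto_div_add_atTop (y : ℝ) : Tendsto (fun t : ℝ => t / (t + y)) atTop (𝓝 1) := by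
  have hlim : Tendsto (fun t : ℝ => 1 - y / (t + y)) atTop (𝓝 (1 - 0)) :=
    tendsto_const_nhds.sub
      (tendsto_const_nhds.div_atTop (tendsto_atTop_add_const_right _ _ tendsto_id))
  rw [sub_zero] at hlim
  refine hlim.congr' ?_
  filter_upwards [eventually_gt_atTop (-y)] with t ht
  have : t + y ≠ 0 := by linarith
  field_simp
  ring

theorem lintegral_Ioi_rpow_mul_div_rpow (hα : -1 < α) (hy : 0 < y) :
    ∫⁻ t in Ioi (0 : ℝ), ENNReal.ofReal (t ^ α * (y / (t + y)) ^ (α + 2)) =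
      ENNReal.ofReal (y ^ (α + 1) / (α + 1)) := by
  have hα1 : 0 < α + 1 := by linarith
  set g : ℝ → ℝ := fun t => y ^ (α + 1) / (α + 1) * (t / (t + y)) ^ (α + 1) with hg
  have hcont : ContinuousWithinAt g (Ici 0) 0 := by
    refine (continuousAt_const.mul (ContinuousAt.rpow_const ?_ (Or.inr hα1.le))).continuousWithinAt
    exact continuousAt_id.div (by fun_prop) (by simpa only [zero_add] using hy.ne')
  have hderiv (t : ℝ) (ht : t ∈ Ioi 0) := hasDerivAt_div_add_rpow ht hy hα1.ne'
  have hnonneg : ∀ t ∈ Ioi (0 : ℝ), 0 ≤ t ^ α * (y / (t + y)) ^ (α + 2) := by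
    rintro t (ht : 0 < t)
    positivity
  have hlim : Tendsto g atTop (𝓝 (y ^ (α + 1) / (α + 1) * 1 ^ (α + 1))) :=
    ((tendsto_div_add_atTop y).rpow_const (Or.inr hα1.le)).const_mul _
  rw [← ofReal_integral_eq_lintegral_ofReal
    (integrableOn_Ioi_deriv_of_nonneg hcont hderiv hnonneg hlim)
    ((ae_restrict_mem measurableSet_Ioi).mono hnonneg),
    integral_Ioi_of_hasDerivAt_of_nonneg hcont hderiv hnonneg hlim]
  simp only [hg, zero_div, Real.zero_rpow hα1.ne', mul_zero, sub_zero, Real.one_rpow, mul_one]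

theorem lintegral_weightedArea_re_im (α : ℝ) {h : ℝ × ℝ → ℝ≥0∞} (hh : Measurable h) :
    ∫⁻ z, h (z.re, z.im) ∂weightedArea α =
      ∫⁻ t in Ioi 0, ENNReal.ofReal (t ^ α) * ∫⁻ x, h (x, t) := by
  have hprod := Complex.volume_preserving_equiv_real_prod.setLIntegral_comp_preimage_emb
    Complex.measurableEquivRealProd.measurableEmbedding
    (fun v : ℝ × ℝ => ENNReal.ofReal (v.2 ^ α) * h v) (univ ×ˢ Ioi 0)
  rw [Measure.volume_eq_prod, ← Measure.prod_restrict, Measure.restrict_univ,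
    lintegral_prod_symm' _ (by fun_prop)] at hprod
  have hset : Complex.measurableEquivRealProd ⁻¹' (univ ×ˢ Ioi 0) =
      UpperHalfPlane.upperHalfPlaneSet := by
    ext w
    simp only [Complex.measurableEquivRealProd_apply, mem_preimage, mem_prod, mem_univ, true_and,
      mem_Ioi, UpperHalfPlane.upperHalfPlaneSet, mem_ofPred_eq]
  simp only [lintegral_const_mul' _ _ ENNReal.ofReal_ne_top, hset] at hprod
  rw [← hprod, lintegral_weightedArea_eq_setLIntegral]
  refine setLIntegral_congr_fun UpperHalfPlane.isOpen_upperHalfPlaneSet.measurableSet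
    fun w hw => ?_
  simp only [UpperHalfPlane.ofComplex_apply_of_im_pos hw, Complex.measurableEquivRealProd_apply]
  rfl

end Integrals

section CauchyKernel

open UpperHalfPlane ComplexConjugate

/-- The Cauchy kernel of the upper half-plane with pole at `conj z`, scaled by the height of `z` so
that it is bounded by `1`. Its powers are the test functions concentrated near `z`. -/
noncomputable def cauchyKernel (z w : ℍ) : ℂ :=
  z.im / (w - conj (z : ℂ))

theorem norm_sq_sub_conj (z w : ℍ) :
    ‖(w : ℂ) - conj (z : ℂ)‖ ^ 2 = (w.re - z.re) ^ 2 + (w.im + z.im) ^ 2 := by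
  rw [Complex.sq_norm, Complex.normSq_apply, Complex.sub_re, Complex.sub_im, Complex.conj_re,
    Complex.conj_im, coe_re, coe_re, coe_im, coe_im]
  ring

theorem im_add_im_le_norm_sub_conj (z w : ℍ) : w.im + z.im ≤ ‖(w : ℂ) - conj (z : ℂ)‖ := by
  refine le_of_sq_le_sq ?_ (norm_nonneg _)
  rw [norm_sq_sub_conj]
  exact le_add_of_nonneg_left (sq_nonneg _)

theorem norm_cauchyKernel (z w : ℍ) :
    ‖cauchyKernel z w‖ = z.im / ‖(w : ℂ) - conj (z : ℂ)‖ := by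
  rw [cauchyKernel, norm_div, Complex.norm_real, Real.norm_of_nonneg z.im_pos.le]

theorem norm_cauchyKernel_pos (z w : ℍ) : 0 < ‖cauchyKernel z w‖ := by
  rw [norm_cauchyKernel]
  exact div_pos z.im_pos ((add_pos w.im_pos z.im_pos).trans_le (im_add_im_le_norm_sub_conj z w))

theorem norm_cauchyKernel_le (z w : ℍ) : ‖cauchyKernel z w‖ ≤ z.im / (w.im + z.im) := by
  rw [norm_cauchyKernel]
  exact div_le_div_of_nonneg_left z.im_pos.le (add_pos w.im_pos z.im_pos)
    (im_add_im_le_norm_sub_conj z w)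

theorem norm_cauchyKernel_le_one (z w : ℍ) : ‖cauchyKernel z w‖ ≤ 1 :=
  (norm_cauchyKernel_le z w).trans <|
    div_le_one_of_le₀ (by linarith [w.im_pos]) (add_pos w.im_pos z.im_pos).le

theorem norm_cauchyKernel_self (z : ℍ) : ‖cauchyKernel z z‖ = 1 / 2 := by
  have := z.im_pos
  have hnorm : ‖(z : ℂ) - conj (z : ℂ)‖ = 2 * z.im := by
    rw [← sq_eq_sq₀ (norm_nonneg _) (by positivity), norm_sq_sub_conj]
    ring
  rw [norm_cauchyKernel, hnorm]
  field_simp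

theorem analytic_cauchyKernel_pow (z : ℍ) (N : ℕ) : Analytic (cauchyKernel z ^ N) := by
  refine UpperHalfPlane.mdifferentiable_iff.2 (DifferentiableOn.congr
    (f := fun w : ℂ => (z.im / (w - conj (z : ℂ))) ^ N) (fun w hw => ?_) fun w hw => ?_)
  · have hne : w - conj (z : ℂ) ≠ 0 := fun h => by
      have him := congrArg Complex.im h
      rw [Complex.sub_im, Complex.conj_im, Complex.zero_im, coe_im] at him
      have hw : 0 < w.im := hw
      linarith [z.im_pos]
    exact DifferentiableAt.differentiableWithinAt (by fun_prop (disch := assumption))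
  · simp only [Function.comp_apply, Pi.pow_apply, cauchyKernel, ofComplex_apply_of_im_pos hw]

theorem norm_cauchyKernel_rpow_le {α : ℝ} (hα : -1 < α) (z w : ℍ) :
    ‖cauchyKernel z w‖ ^ (α + 4) ≤ (z.im / (w.im + z.im)) ^ (α + 2) *
      (z.im * ((w.im + z.im) / ((w.re - z.re) ^ 2 + (w.im + z.im) ^ 2))) := by
  have := z.im_pos
  have := w.im_pos
  have hsq : ‖cauchyKernel z w‖ ^ 2 ≤
      z.im * ((w.im + z.im) / ((w.re - z.re) ^ 2 + (w.im + z.im) ^ 2)) := by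
    rw [norm_cauchyKernel, div_pow, norm_sq_sub_conj, mul_div_assoc', sq z.im]
    gcongr
    linarith
  rw [show α + 4 = α + 2 + (2 : ℕ) by push_cast; ring,
    Real.rpow_add_natCast (norm_cauchyKernel_pos z w).ne']
  gcongr
  · linarith
  · exact norm_cauchyKernel_le z w

theorem lintegral_norm_cauchyKernel_rpow_le {α : ℝ} (hα : -1 < α) (z : ℍ) :
    ∫⁻ w, ENNReal.ofReal (‖cauchyKernel z w‖ ^ (α + 4)) ∂weightedArea α ≤
      ENNReal.ofReal (Real.pi / (α + 1) * z.im ^ (2 + α)) := by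
  have hy := z.im_pos
  set h : ℝ × ℝ → ℝ≥0∞ := fun v =>
    ENNReal.ofReal ((z.im / (v.2 + z.im)) ^ (α + 2) * z.im) *
      ENNReal.ofReal ((v.2 + z.im) / ((v.1 - z.re) ^ 2 + (v.2 + z.im) ^ 2)) with hh
  calc ∫⁻ w, ENNReal.ofReal (‖cauchyKernel z w‖ ^ (α + 4)) ∂weightedArea α
      ≤ ∫⁻ w, h (w.re, w.im) ∂weightedArea α := by
        refine lintegral_mono fun w => ?_
        have := w.im_pos
        rw [hh]
        dsimp only
        rw [← ENNReal.ofReal_mul (by positivity), mul_assoc]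
        exact ENNReal.ofReal_le_ofReal (norm_cauchyKernel_rpow_le hα z w)
    _ = ∫⁻ t in Ioi 0, ENNReal.ofReal (t ^ α) * ∫⁻ x, h (x, t) :=
        lintegral_weightedArea_re_im α (by fun_prop)
    _ = ∫⁻ t in Ioi 0, ENNReal.ofReal (Real.pi * z.im) *
          ENNReal.ofReal (t ^ α * (z.im / (t + z.im)) ^ (α + 2)) := by
        refine setLIntegral_congr_fun measurableSet_Ioi fun t ht => ?_
        have ht : 0 < t := ht
        simp only [hh]
        rw [lintegral_const_mul' _ _ ENNReal.ofReal_ne_top,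
          lintegral_div_sub_sq_add_sq _ (by positivity), ← ENNReal.ofReal_mul (by positivity),
          ← ENNReal.ofReal_mul (by positivity), ← ENNReal.ofReal_mul (by positivity)]
        ring_nf
    _ = ENNReal.ofReal (Real.pi / (α + 1) * z.im ^ (2 + α)) := by
        rw [lintegral_const_mul' _ _ ENNReal.ofReal_ne_top, lintegral_Ioi_rpow_mul_div_rpow hα hy,
          ← ENNReal.ofReal_mul (by positivity), show 2 + α = α + 1 + 1 by ring,
          Real.rpow_add_one hy.ne' (α + 1)]
        ring_nf

theorem IsGrowth.exists_testFunction {Φ : ℝ → ℝ} {p α : ℝ} (h : IsGrowth Φ) (hp : 0 < p)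
    (hlow : LowerType p Φ) (hα : -1 < α) :
    ∃ c : ℝ, 0 < c ∧ ∀ z : ℍ, ∃ F : ℍ → ℂ, Analytic F ∧ modular Φ α F ≤ 1 ∧
      ‖F z‖ = c * evalScale Φ α z.im := by
  have hα1 : 0 < α + 1 := by linarith
  have := Real.pi_pos
  obtain ⟨δ, hδ, N, hle⟩ := h.exists_map_mul_pow_le hp hlow
    (ε := (Real.pi / (α + 1))⁻¹) (by positivity) (α + 4)
  refine ⟨δ * (1 / 2) ^ N, by positivity, fun z => ?_⟩
  have hy := z.im_pos
  have hu := h.evalScale_pos α hy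
  set u := evalScale Φ α z.im with hu_def
  have hnorm (w : ℍ) : ‖(((δ * u : ℝ) : ℂ) • cauchyKernel z ^ N) w‖ =
      δ * (u * ‖cauchyKernel z w‖ ^ N) := by
    rw [Pi.smul_apply, Pi.pow_apply, norm_smul, norm_pow, Complex.norm_real,
      Real.norm_of_nonneg (by positivity), mul_assoc]
  refine ⟨((δ * u : ℝ) : ℂ) • cauchyKernel z ^ N,
    (analytic_cauchyKernel_pow z N).const_smul _, ?_, ?_⟩
  · calc modular Φ α (((δ * u : ℝ) : ℂ) • cauchyKernel z ^ N)
        ≤ ∫⁻ w, ENNReal.ofReal ((Real.pi / (α + 1))⁻¹ * Φ u) *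
            ENNReal.ofReal (‖cauchyKernel z w‖ ^ (α + 4)) ∂weightedArea α :=
          lintegral_mono fun w => by
            have hΦu := h.nonneg hu.le
            rw [hnorm, ← ENNReal.ofReal_mul (by positivity), mul_right_comm]
            exact ENNReal.ofReal_le_ofReal
              (hle hu ⟨norm_cauchyKernel_pos z w, norm_cauchyKernel_le_one z w⟩)
      _ ≤ ENNReal.ofReal ((Real.pi / (α + 1))⁻¹ * Φ u) *
            ENNReal.ofReal (Real.pi / (α + 1) * z.im ^ (2 + α)) := by
          rw [lintegral_const_mul' _ _ ENNReal.ofReal_ne_top]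
          exact mul_le_mul_right (lintegral_norm_cauchyKernel_rpow_le hα z) _
      _ = 1 := by
          rw [hu_def, h.map_evalScale α hy, ← ENNReal.ofReal_mul (by positivity),
            ← ENNReal.ofReal_one]
          congr 1
          field_simp
  · rw [hnorm, norm_cauchyKernel_self]
    ring

end CauchyKernel

/-! ### Necessity -/

section Necessity

variable {Φ₁ Φ₂ : ℝ → ℝ} {α β : ℝ} {G : ℍ → ℂ} {ω : ℝ → ℝ}

theorem multWeight_pos (h₁ : IsGrowth Φ₁) (h₂ : IsGrowth Φ₂) (α β : ℝ) {t : ℝ} (ht : 0 < t) :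
    0 < multWeight Φ₁ α Φ₂ β t :=
  div_pos (h₂.evalScale_pos β ht) (h₁.evalScale_pos α ht)

theorem mem_weightedHInfty_iff (hω : ∀ t, 0 < t → 0 < ω t) :
    G ∈ weightedHInfty ω ↔ Analytic G ∧ ∃ M : ℝ, 0 < M ∧ ∀ z : ℍ, ‖G z‖ ≤ M * ω z.im := by
  refine and_congr_right fun _ => ⟨fun hbdd => ?_, fun ⟨M, _, hM⟩ => ⟨M, ?_⟩⟩
  · obtain ⟨M, hM, hle⟩ := hbdd.exists_ge 1
    exact ⟨M, one_pos.trans_le hM, fun z => (div_le_iff₀ (hω _ z.im_pos)).1 (hle _ ⟨z, rfl⟩)⟩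
  · exact forall_mem_range.2 fun z => (div_le_iff₀ (hω _ z.im_pos)).2 (hM z)

theorem mem_hInfty_iff : G ∈ hInfty ↔ Analytic G ∧ ∃ M : ℝ, 0 < M ∧ ∀ z : ℍ, ‖G z‖ ≤ M := by
  have hone : hInfty = weightedHInfty 1 := by
    simp only [hInfty, weightedHInfty, Pi.one_apply, div_one]
  simpa only [hone, Pi.one_apply, mul_one] using
    mem_weightedHInfty_iff (G := G) (ω := 1) fun _ _ => one_pos

theorem exists_norm_le_mul_multWeight_of_mem_multipliers (h₁ : IsModerateGrowth Φ₁)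
    (h₂ : IsModerateGrowth Φ₂) (hα : -1 < α) (hG : G ∈ multipliers Φ₁ α Φ₂ β) :
    ∃ M : ℝ, 0 < M ∧ ∀ z : ℍ, ‖G z‖ ≤ M * multWeight Φ₁ α Φ₂ β z.im := by
  obtain ⟨hG, C, hC, hmul⟩ := hG
  obtain ⟨p, hp, hlow⟩ := h₁.lowerType
  obtain ⟨c, hc, htest⟩ := h₁.exists_testFunction hp hlow hα
  obtain ⟨K, hK, heval⟩ := h₂.exists_norm_le_mul_evalScale β
  have := one_pos.trans_le hK
  refine ⟨2 * C * K / c, by positivity, fun z => ?_⟩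
  obtain ⟨F, hF, hmod, hFz⟩ := htest z
  have hu := h₁.evalScale_pos α z.im_pos
  have hv := h₂.evalScale_pos β z.im_pos
  have hFnorm : luxNorm Φ₁ α F ≤ ENNReal.ofReal 1 :=
    luxNorm_le_ofReal one_pos (by simpa only [Complex.ofReal_one, inv_one, one_smul] using hmod)
  have hFGnorm : luxNorm Φ₂ β (F * G) < ENNReal.ofReal (2 * C) := by
    calc luxNorm Φ₂ β (F * G) ≤ ENNReal.ofReal C * luxNorm Φ₁ α F :=
          (hmul F ⟨hF, hFnorm.trans_lt ENNReal.ofReal_lt_top⟩).2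
      _ ≤ ENNReal.ofReal C * ENNReal.ofReal 1 := by gcongr
      _ < ENNReal.ofReal (2 * C) := by
        rw [← ENNReal.ofReal_mul hC.le, ENNReal.ofReal_lt_ofReal_iff (by positivity)]
        linarith
  obtain ⟨l, hl, hlC, hmodFG⟩ := exists_modular_le_one_of_luxNorm_lt hFGnorm
  have hlC : l ≤ 2 * C := ((ENNReal.ofReal_lt_ofReal_iff (by positivity)).1 hlC).le
  have hFGz := heval _ ((hF.mul hG).const_smul (l : ℂ)⁻¹) hmodFG z
  rw [norm_inv_smul_mul_apply hl, hFz, div_le_iff₀ hl] at hFGz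
  rw [multWeight_eq_div, div_mul_div_comm, le_div_iff₀ (by positivity)]
  calc ‖G z‖ * (c * evalScale Φ₁ α z.im) = c * evalScale Φ₁ α z.im * ‖G z‖ := mul_comm _ _
    _ ≤ K * evalScale Φ₂ β z.im * l := hFGz
    _ ≤ K * evalScale Φ₂ β z.im * (2 * C) := by gcongr
    _ = 2 * C * K * evalScale Φ₂ β z.im := by ring

end Necessity

/-! ### Sufficiency -/

section Sufficiency

variable {Φ Φ₁ Φ₂ : ℝ → ℝ} {α β a L M : ℝ} {G : ℍ → ℂ}

theorem mem_multipliers_of_modular_le (hG : Analytic G) (hL : 0 < L)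
    (h : ∀ F : ℍ → ℂ, Analytic F → modular Φ₁ α F ≤ 1 →
      modular Φ₂ β ((L : ℂ)⁻¹ • (F * G)) ≤ 1) :
    G ∈ multipliers Φ₁ α Φ₂ β := by
  have hnorm (F : ℍ → ℂ) (hF : Analytic F) :
      luxNorm Φ₂ β (F * G) ≤ ENNReal.ofReal L * luxNorm Φ₁ α F := by
    have hL0 : ENNReal.ofReal L ≠ 0 := (ENNReal.ofReal_pos.2 hL).ne'
    conv_rhs => simp only [luxNorm, ENNReal.mul_iInf_of_ne hL0 ENNReal.ofReal_ne_top,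
      ← ENNReal.ofReal_mul hL.le]
    refine le_iInf₂ fun l ⟨hl, hmod⟩ => luxNorm_le_ofReal (mul_pos hL hl) ?_
    rw [← modular_inv_smul hl] at hmod
    have hscale : ((L * l : ℝ) : ℂ)⁻¹ • (F * G) = (L : ℂ)⁻¹ • (((l : ℂ)⁻¹ • F) * G) := by
      rw [Complex.ofReal_mul, mul_inv, mul_smul, smul_mul_assoc]
    rw [hscale]
    exact h _ (hF.const_smul _) hmod
  exact ⟨hG, L, hL, fun F hF => ⟨⟨hF.1.mul hG,
    (hnorm F hF.1).trans_lt (ENNReal.mul_lt_top ENNReal.ofReal_lt_top hF.2)⟩, hnorm F hF.1⟩⟩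

theorem zero_mem_multipliers (h₂ : IsGrowth Φ₂) (Φ₁ : ℝ → ℝ) (α β : ℝ) :
    0 ∈ multipliers Φ₁ α Φ₂ β := by
  have hzero : Analytic 0 := mdifferentiable_const
  refine mem_multipliers_of_modular_le hzero one_pos fun F _ _ => ?_
  simp only [mul_zero, smul_zero, modular, Pi.zero_apply, norm_zero, h₂.map_zero,
    ENNReal.ofReal_zero, lintegral_zero, zero_le]

theorem IsModerateGrowth.exists_forall_mem_multipliers (h₁ : IsModerateGrowth Φ₁)
    (h₂ : IsGrowth Φ₂) (α β : ℝ) :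
    ∃ K : ℝ, 1 ≤ K ∧ ∀ {G : ℍ → ℂ} {L : ℝ}, Analytic G → 0 < L →
      (∀ (z : ℍ) (x : ℝ), 0 < x → x ≤ K * evalScale Φ₁ α z.im →
        z.im ^ β * Φ₂ (x * ‖G z‖ / L) ≤ z.im ^ α * Φ₁ x) →
      G ∈ multipliers Φ₁ α Φ₂ β := by
  obtain ⟨K, hK, heval⟩ := h₁.exists_norm_le_mul_evalScale α
  refine ⟨K, hK, fun {G L} hG hL h => mem_multipliers_of_modular_le hG hL fun F hF hmod =>
    (modular_le_modular fun z => ?_).trans hmod⟩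
  rw [norm_inv_smul_mul_apply hL]
  rcases (norm_nonneg (F z)).eq_or_lt with hFz | hFz
  · simp only [← hFz, zero_mul, zero_div, h₂.map_zero, h₁.map_zero, mul_zero, le_refl]
  · exact h z _ hFz (heval F hF hmod z)

theorem rpow_mul_map_le_map_mul (hΦ : AntitoneOn (fun t => Φ t / t ^ a) (Ioi 0)) {s τ : ℝ}
    (hs : 0 < s) (hτ : 0 < τ) (hτ1 : τ ≤ 1) : τ ^ a * Φ s ≤ Φ (τ * s) := by
  have hle : Φ s / s ^ a ≤ Φ (τ * s) / (τ * s) ^ a :=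
    hΦ (mul_pos hτ hs) hs (mul_le_of_le_one_left hs.le hτ1)
  rw [Real.mul_rpow hτ.le hs.le, div_le_div_iff₀ (by positivity) (by positivity)] at hle
  refine le_of_mul_le_mul_right ?_ (Real.rpow_pos_of_pos hs a)
  linarith

theorem map_mul_le_rpow_mul_map (hΦ : MonotoneOn (fun t => Φ t / t ^ a) (Ioi 0)) {s τ : ℝ}
    (hs : 0 < s) (hτ : 0 < τ) (hτ1 : τ ≤ 1) : Φ (τ * s) ≤ τ ^ a * Φ s := by
  have hle : Φ (τ * s) / (τ * s) ^ a ≤ Φ s / s ^ a :=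
    hΦ (mul_pos hτ hs) hs (mul_le_of_le_one_left hs.le hτ1)
  rw [Real.mul_rpow hτ.le hs.le, div_le_div_iff₀ (by positivity) (by positivity)] at hle
  refine le_of_mul_le_mul_right ?_ (Real.rpow_pos_of_pos hs a)
  linarith

theorem rpow_mul_map_evalScale_mul_le (h₁ : IsGrowth Φ₁) (h₂ : IsGrowth Φ₂)
    (hΦ₁ : AntitoneOn (fun t => Φ₁ t / t ^ a) (Ioi 0))
    (hΦ₂ : MonotoneOn (fun t => Φ₂ t / t ^ a) (Ioi 0)) (α β : ℝ) {y τ : ℝ} (hy : 0 < y)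
    (hτ : 0 < τ) (hτ1 : τ ≤ 1) :
    y ^ β * Φ₂ (τ * evalScale Φ₂ β y) ≤ y ^ α * Φ₁ (τ * evalScale Φ₁ α y) := by
  calc y ^ β * Φ₂ (τ * evalScale Φ₂ β y)
      ≤ y ^ β * (τ ^ a * Φ₂ (evalScale Φ₂ β y)) := by
        gcongr
        exact map_mul_le_rpow_mul_map hΦ₂ (h₂.evalScale_pos β hy) hτ hτ1
    _ = y ^ α * (τ ^ a * Φ₁ (evalScale Φ₁ α y)) := by
        rw [mul_left_comm, h₂.rpow_mul_map_evalScale β hy, mul_left_comm,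
          h₁.rpow_mul_map_evalScale α hy]
    _ ≤ y ^ α * Φ₁ (τ * evalScale Φ₁ α y) := by
        gcongr
        exact rpow_mul_map_le_map_mul hΦ₁ (h₁.evalScale_pos α hy) hτ hτ1

theorem mem_multipliers_of_norm_le_mul_multWeight (h₁ : IsModerateGrowth Φ₁) (h₂ : IsGrowth Φ₂)
    (hΦ₁ : AntitoneOn (fun t => Φ₁ t / t ^ a) (Ioi 0))
    (hΦ₂ : MonotoneOn (fun t => Φ₂ t / t ^ a) (Ioi 0)) (hG : Analytic G) (hM : 0 < M)
    (hle : ∀ z : ℍ, ‖G z‖ ≤ M * multWeight Φ₁ α Φ₂ β z.im) :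
    G ∈ multipliers Φ₁ α Φ₂ β := by
  obtain ⟨K, hK, hcrit⟩ := h₁.exists_forall_mem_multipliers h₂ α β
  have hK0 : 0 < K := one_pos.trans_le hK
  refine hcrit hG (mul_pos hK0 hM) fun z x hx hxK => ?_
  have hy := z.im_pos
  have hu := h₁.evalScale_pos α hy
  have hGz := hle z
  rw [multWeight_eq_div] at hGz
  set u := evalScale Φ₁ α z.im
  set v := evalScale Φ₂ β z.im
  set τ := x / (K * u) with hτ
  have hτ0 : 0 < τ := by positivity
  have hτ1 : τ ≤ 1 := div_le_one_of_le₀ hxK (by positivity)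
  have hxG : x * ‖G z‖ / (K * M) ≤ τ * v := by
    calc x * ‖G z‖ / (K * M) ≤ x * (M * (v / u)) / (K * M) := by gcongr
      _ = τ * v := by rw [hτ]; field_simp
  have hτu : τ * u ≤ x := by
    calc τ * u = x / K := by rw [hτ]; field_simp
      _ ≤ x := div_le_self hx.le hK
  calc z.im ^ β * Φ₂ (x * ‖G z‖ / (K * M)) ≤ z.im ^ β * Φ₂ (τ * v) := by
        gcongr
        exact h₂.map_le_map (by positivity) hxG
    _ ≤ z.im ^ α * Φ₁ (τ * u) := rpow_mul_map_evalScale_mul_le h₁.1 h₂ hΦ₁ hΦ₂ α β hy hτ0 hτ1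
    _ ≤ z.im ^ α * Φ₁ x := by
        gcongr
        exact h₁.map_le_map (by positivity) hτu

theorem exists_rpow_mul_map_le_of_le_multWeight {c : ℝ} (h₁ : IsModerateGrowth Φ₁)
    (h₂ : IsGrowth Φ₂) (hmono : MonotoneOn (fun t => Φ₂ t / Φ₁ t) (Ioi 0)) (hc : 0 < c)
    (hω : ∀ t : ℝ, 0 < t → c⁻¹ ≤ multWeight Φ₁ α Φ₂ β t) :
    ∃ D : ℝ, 0 < D ∧ ∀ {y s : ℝ}, 0 < y → 0 < s → c * s ≤ evalScale Φ₁ α y →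
      y ^ β * Φ₂ s ≤ D * (y ^ α * Φ₁ s) := by
  obtain ⟨D, hD, hdil⟩ := h₁.exists_map_mul_le hc
  refine ⟨D, hD, fun {y s} hy hs hsu => ?_⟩
  have hu := h₁.evalScale_pos α hy
  have hωy := hω y hy
  have hbalance : y ^ β * Φ₂ (evalScale Φ₂ β y) = y ^ α * Φ₁ (evalScale Φ₁ α y) := by
    rw [h₁.rpow_mul_map_evalScale α hy, h₂.rpow_mul_map_evalScale β hy]
  rw [multWeight_eq_div, le_div_iff₀ hu, inv_mul_le_iff₀ hc] at hωy
  set u := evalScale Φ₁ α y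
  set v := evalScale Φ₂ β y
  have hsv : s ≤ v := le_of_mul_le_mul_left (hsu.trans hωy) hc
  have hv : 0 < v := hs.trans_le hsv
  have hΦs := h₁.pos hs
  have hΦv := h₁.pos hv
  have hquot : Φ₂ s ≤ Φ₂ v / Φ₁ v * Φ₁ s := (div_le_iff₀ hΦs).1 (hmono hs hv hsv)
  have huv : Φ₁ u ≤ D * Φ₁ v := (h₁.map_le_map hu.le hωy).trans (hdil v hv.le)
  calc y ^ β * Φ₂ s ≤ y ^ β * (Φ₂ v / Φ₁ v * Φ₁ s) := by gcongr
    _ = y ^ α * Φ₁ u / Φ₁ v * Φ₁ s := by rw [← hbalance]; ring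
    _ ≤ y ^ α * (D * Φ₁ v) / Φ₁ v * Φ₁ s := by gcongr
    _ = D * (y ^ α * Φ₁ s) := by field_simp

theorem mem_multipliers_of_norm_le {c : ℝ} (h₁ : IsModerateGrowth Φ₁) (h₂ : IsGrowth Φ₂)
    (hmono : MonotoneOn (fun t => Φ₂ t / Φ₁ t) (Ioi 0)) (hc : 0 < c)
    (hω : ∀ t : ℝ, 0 < t → c⁻¹ ≤ multWeight Φ₁ α Φ₂ β t) (hG : Analytic G) (hM : 0 < M)
    (hle : ∀ z : ℍ, ‖G z‖ ≤ M) : G ∈ multipliers Φ₁ α Φ₂ β := by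
  obtain ⟨K, hK, hcrit⟩ := h₁.exists_forall_mem_multipliers h₂ α β
  have := one_pos.trans_le hK
  obtain ⟨D, hD, hcomp⟩ := exists_rpow_mul_map_le_of_le_multWeight h₁ h₂ hmono hc hω
  obtain ⟨δ, ⟨hδ, -⟩, hshrink⟩ := h₁.exists_map_mul_le_mul (inv_pos.2 hD)
  set ρ := min δ (c * K)⁻¹
  have hρ : 0 < ρ := by positivity
  refine hcrit hG (div_pos hM hρ) fun z x hx hxK => ?_
  have hy := z.im_pos
  have hρx : c * (ρ * x) ≤ evalScale Φ₁ α z.im := by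
    calc c * (ρ * x) ≤ c * ((c * K)⁻¹ * (K * evalScale Φ₁ α z.im)) := by
          gcongr
          exact min_le_right _ _
      _ = evalScale Φ₁ α z.im := by field_simp
  calc z.im ^ β * Φ₂ (x * ‖G z‖ / (M / ρ)) ≤ z.im ^ β * Φ₂ (ρ * x) := by
        gcongr
        refine h₂.map_le_map (by positivity) ?_
        rw [div_div_eq_mul_div, div_le_iff₀ hM, mul_comm ρ]
        calc x * ‖G z‖ * ρ ≤ x * M * ρ := by gcongr; exact hle z
          _ = x * ρ * M := by ring
    _ ≤ D * (z.im ^ α * Φ₁ (ρ * x)) := hcomp hy (mul_pos hρ hx) hρx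
    _ ≤ D * (z.im ^ α * (D⁻¹ * Φ₁ x)) := by
        gcongr
        exact (h₁.map_le_map (by positivity) (by gcongr; exact min_le_left _ _)).trans
          (hshrink x hx.le)
    _ = z.im ^ α * Φ₁ x := by field_simp

end Sufficiency

/-! ### Vanishing at the boundary -/

section Vanishing

open Complex.HadamardThreeLines
open UpperHalfPlane hiding verticalStrip

variable {Φ Φ₁ Φ₂ : ℝ → ℝ} {G : ℍ → ℂ} {η : ℝ → ℝ}

theorem IsGrowth.exists_isMinOn_isMaxOn_evalScale (h : IsGrowth Φ) (α : ℝ) {a b : ℝ} (ha : 0 < a)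
    (hab : a ≤ b) :
    (∃ s ∈ Icc a b, IsMinOn (evalScale Φ α) (Icc a b) s) ∧
      ∃ s ∈ Icc a b, IsMaxOn (evalScale Φ α) (Icc a b) s := by
  have hpos (s : ℝ) (hs : s ∈ Icc a b) : 0 < s ^ (2 + α) :=
    Real.rpow_pos_of_pos (ha.trans_le hs.1) _
  have hcont : ContinuousOn (fun s : ℝ => 1 / s ^ (2 + α)) (Icc a b) :=
    continuousOn_const.div (continuousOn_id.rpow_const fun s hs => Or.inl (ha.trans_le hs.1).ne')
      fun s hs => (hpos s hs).ne'
  have hmono (s t : ℝ) (hs : s ∈ Icc a b) (ht : t ∈ Icc a b)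
      (hst : 1 / s ^ (2 + α) ≤ 1 / t ^ (2 + α)) : evalScale Φ α s ≤ evalScale Φ α t :=
    h.monotoneOn_growthInv (one_div_pos.2 (hpos s hs)).le (one_div_pos.2 (hpos t ht)).le hst
  obtain ⟨s, hs, hmin⟩ := isCompact_Icc.exists_isMinOn (nonempty_Icc.2 hab) hcont
  obtain ⟨t, ht, hmax⟩ := isCompact_Icc.exists_isMaxOn (nonempty_Icc.2 hab) hcont
  exact ⟨⟨s, hs, fun r hr => hmono s r hs hr (hmin hr)⟩,
    t, ht, fun r hr => hmono r t hr ht (hmax hr)⟩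

theorem bddAbove_multWeight_image_Icc (h₁ : IsGrowth Φ₁) (h₂ : IsGrowth Φ₂) (α β : ℝ) {a b : ℝ}
    (ha : 0 < a) (hab : a ≤ b) : BddAbove (multWeight Φ₁ α Φ₂ β '' Icc a b) := by
  obtain ⟨⟨s, hs, hmin⟩, -⟩ := h₁.exists_isMinOn_isMaxOn_evalScale α ha hab
  obtain ⟨-, t, ht, hmax⟩ := h₂.exists_isMinOn_isMaxOn_evalScale β ha hab
  exact ⟨evalScale Φ₂ β t / evalScale Φ₁ α s, forall_mem_image.2 fun r hr =>
    div_le_div₀ (h₂.evalScale_pos β (ha.trans_le ht.1)).le (hmax hr)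
      (h₁.evalScale_pos α (ha.trans_le hs.1)) (hmin hr)⟩

theorem nonneg_of_norm_le (hle : ∀ z : ℍ, ‖G z‖ ≤ η z.im) {t : ℝ} (ht : 0 < t) : 0 ≤ η t := by
  have hI := hle ((⟨t, ht⟩ : {x : ℝ // 0 < x}) • I)
  rw [pos_real_im, I_im, mul_one] at hI
  exact (norm_nonneg _).trans hI

theorem sq_norm_le_mul_of_norm_le (hG : Analytic G)
    (hη : ∀ a b : ℝ, 0 < a → a ≤ b → BddAbove (η '' Icc a b)) (hle : ∀ z : ℍ, ‖G z‖ ≤ η z.im)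
    (z : ℍ) {l : ℝ} (hl : 0 < l) (hlz : l < z.im) : ‖G z‖ ^ 2 ≤ η l * η (2 * z.im - l) := by
  set u := 2 * z.im - l
  have hlu : l < u := by linarith
  have him (w : ℂ) : (z.re + w * Complex.I).im = w.re := by
    simp only [Complex.add_im, Complex.ofReal_im, Complex.mul_I_im, zero_add]
  set f : ℂ → ℂ := fun w => (G ∘ ofComplex) (z.re + w * Complex.I)
  have hfz : f z.im = G z := by
    simp only [f, re_add_im, Function.comp_apply, ofComplex_apply]
  have hfd : DifferentiableOn ℂ f {w | 0 < w.re} :=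
    hG.differentiableOn.comp (by fun_prop) fun w hw => (hw : 0 < w.re).trans_eq (him w).symm
  have hfle (w : ℂ) (hw : 0 < w.re) : ‖f w‖ ≤ η w.re := by
    have hwim := hw.trans_eq (him w).symm
    have hw' := hle ⟨z.re + w * Complex.I, hwim⟩
    rw [UpperHalfPlane.im, him] at hw'
    simpa only [f, Function.comp_apply, ofComplex_apply_of_im_pos hwim] using hw'
  have hclosed : closure (verticalStrip l u) ⊆ {w | 0 < w.re} := by
    refine (closure_minimal (preimage_mono Ioo_subset_Icc_self)
      (isClosed_Icc.preimage Complex.continuous_re)).trans fun w hw => hl.trans_le hw.1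
  have hbdd : BddAbove ((norm ∘ f) '' verticalClosedStrip l u) := by
    obtain ⟨B, hB⟩ := hη l u hl hlu.le
    exact ⟨B, forall_mem_image.2 fun w hw =>
      (hfle w (hl.trans_le hw.1)).trans (hB (mem_image_of_mem η hw))⟩
  have hinterp := norm_le_interp_of_mem_verticalClosedStrip' (z := z.im) (a := η l) (b := η u) hlu
    ⟨by simpa using hlz.le, by simp only [Complex.ofReal_re]; linarith⟩
    (hfd.mono hclosed).diffContOnCl hbdd
    (fun w hw => (hw : w.re = l) ▸ hfle w (hl.trans_eq hw.symm))
    (fun w hw => (hw : w.re = u) ▸ hfle w ((hl.trans hlu).trans_eq hw.symm))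
  have hmid : (z.im - l) / (u - l) = 1 / 2 := by
    rw [div_eq_div_iff (by linarith) two_ne_zero]
    linarith
  have hηl := nonneg_of_norm_le hle hl
  have hηu := nonneg_of_norm_le hle (hl.trans hlu)
  rw [hfz, Complex.ofReal_re, hmid, sub_half, ← Real.sqrt_eq_rpow, ← Real.sqrt_eq_rpow,
    ← Real.sqrt_mul hηl] at hinterp
  exact (Real.le_sqrt (norm_nonneg _) (mul_nonneg hηl hηu)).1 hinterp

theorem eq_zero_of_norm_le_of_tendsto_zero (hG : Analytic G)
    (hη : ∀ a b : ℝ, 0 < a → a ≤ b → BddAbove (η '' Icc a b)) (hle : ∀ z : ℍ, ‖G z‖ ≤ η z.im)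
    (hlim : Tendsto η (𝓝[>] 0) (𝓝 0)) : G = 0 := by
  funext z
  have hz := z.im_pos
  obtain ⟨B, hB⟩ := hη z.im (2 * z.im) hz (by linarith)
  have hsq : ∀ l ∈ Ioo 0 z.im, ‖G z‖ ^ 2 ≤ η l * B := fun l ⟨hl, hlz⟩ => by
    refine (sq_norm_le_mul_of_norm_le hG hη hle z hl hlz).trans ?_
    gcongr
    · exact nonneg_of_norm_le hle hl
    · exact hB (mem_image_of_mem η ⟨by linarith, by linarith⟩)
  have hzero : ‖G z‖ ^ 2 ≤ 0 * B :=
    ge_of_tendsto (hlim.mul_const B) (mem_of_superset (Ioo_mem_nhdsGT hz) hsq)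
  rw [zero_mul] at hzero
  exact norm_eq_zero.1 (pow_eq_zero_iff two_ne_zero |>.1 (hzero.antisymm (sq_nonneg _)))

end Vanishing

/-! ### Spaces of multipliers -/

section Multipliers

variable {Φ₁ Φ₂ : ℝ → ℝ} {α : ℝ}

theorem multipliers_eq_weightedHInfty (h₁ : IsModerateGrowth Φ₁) (h₂ : IsModerateGrowth Φ₂)
    (hd₁ : DifferentiableOn ℝ Φ₁ (Ioi 0)) (hd₂ : DifferentiableOn ℝ Φ₂ (Ioi 0))
    (hindex : upperIndex Φ₁ < lowerIndex Φ₂) (hα : -1 < α) (β : ℝ) :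
    multipliers Φ₁ α Φ₂ β = weightedHInfty (multWeight Φ₁ α Φ₂ β) := by
  obtain ⟨a, ha₁, ha₂⟩ := EReal.lt_iff_exists_real_btwn.1 hindex
  have hΦ₁ := antitoneOn_div_rpow_of_upperIndex_le hd₁ (fun _ => h₁.pos) ha₁.le
  have hΦ₂ := monotoneOn_div_rpow_of_le_lowerIndex hd₂ (fun _ => h₂.pos) ha₂.le
  ext G
  rw [mem_weightedHInfty_iff fun t => multWeight_pos h₁.1 h₂.1 α β]
  refine ⟨fun hG => ⟨hG.1, exists_norm_le_mul_multWeight_of_mem_multipliers h₁ h₂ hα hG⟩, ?_⟩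
  rintro ⟨hG, M, hM, hle⟩
  exact mem_multipliers_of_norm_le_mul_multWeight h₁ h₂.1 hΦ₁ hΦ₂ hG hM hle

theorem multipliers_eq_hInfty (h₁ : IsModerateGrowth Φ₁) (h₂ : IsModerateGrowth Φ₂)
    (hmono : MonotoneOn (fun t => Φ₂ t / Φ₁ t) (Ioi 0)) (hα : -1 < α) {β c : ℝ} (hc : 0 < c)
    (hω : ∀ t : ℝ, 0 < t → c⁻¹ ≤ multWeight Φ₁ α Φ₂ β t ∧ multWeight Φ₁ α Φ₂ β t ≤ c) :
    multipliers Φ₁ α Φ₂ β = hInfty := by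
  ext G
  rw [mem_hInfty_iff]
  constructor
  · intro hG
    obtain ⟨M, hM, hle⟩ := exists_norm_le_mul_multWeight_of_mem_multipliers h₁ h₂ hα hG
    refine ⟨hG.1, M * c, mul_pos hM hc, fun z => (hle z).trans ?_⟩
    gcongr
    exact (hω _ z.im_pos).2
  · rintro ⟨hG, M, hM, hle⟩
    exact mem_multipliers_of_norm_le h₁ h₂.1 hmono hc (fun t ht => (hω t ht).1) hG hM hle

theorem multipliers_eq_singleton_zero (h₁ : IsModerateGrowth Φ₁) (h₂ : IsModerateGrowth Φ₂)
    (hα : -1 < α) {β : ℝ} (hlim : Tendsto (multWeight Φ₁ α Φ₂ β) (𝓝[>] 0) (𝓝 0)) :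
    multipliers Φ₁ α Φ₂ β = {0} := by
  refine Subset.antisymm (fun G hG => ?_)
    (singleton_subset_iff.2 (zero_mem_multipliers h₂.1 Φ₁ α β))
  obtain ⟨M, hM, hle⟩ := exists_norm_le_mul_multWeight_of_mem_multipliers h₁ h₂ hα hG
  refine eq_zero_of_norm_le_of_tendsto_zero (η := fun t => M * multWeight Φ₁ α Φ₂ β t) hG.1
    (fun a b ha hab => ?_) hle ?_
  · obtain ⟨B, hB⟩ := bddAbove_multWeight_image_Icc h₁.1 h₂.1 α β ha hab
    exact ⟨M * B, forall_mem_image.2 fun t ht =>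
      mul_le_mul_of_nonneg_left (hB (mem_image_of_mem _ ht)) hM.le⟩
  · simpa only [mul_zero] using hlim.const_mul M

end Multipliers

end BergmanOrlicz

theorem theorem2p6_general (Φ₁ Φ₂ : ℝ → ℝ) (α β : ℝ)
    (h₁ : BergmanOrlicz.IsModerateGrowth Φ₁) (h₂ : BergmanOrlicz.IsModerateGrowth Φ₂)
    (hα : -1 < α) :
    (DifferentiableOn ℝ Φ₁ (Ioi 0) → DifferentiableOn ℝ Φ₂ (Ioi 0) →
      BergmanOrlicz.upperIndex Φ₁ < BergmanOrlicz.lowerIndex Φ₂ →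
      BergmanOrlicz.multipliers Φ₁ α Φ₂ β =
        BergmanOrlicz.weightedHInfty (BergmanOrlicz.multWeight Φ₁ α Φ₂ β)) ∧
    (MonotoneOn (fun t => Φ₂ t / Φ₁ t) (Ioi 0) →
      (∃ c : ℝ, 0 < c ∧ ∀ t : ℝ, 0 < t →
        c⁻¹ ≤ BergmanOrlicz.multWeight Φ₁ α Φ₂ β t ∧
        BergmanOrlicz.multWeight Φ₁ α Φ₂ β t ≤ c) →
      BergmanOrlicz.multipliers Φ₁ α Φ₂ β = BergmanOrlicz.hInfty) ∧
    (Tendsto (BergmanOrlicz.multWeight Φ₁ α Φ₂ β) (𝓝[>] 0) (𝓝 0) →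
      BergmanOrlicz.multipliers Φ₁ α Φ₂ β = {0}) :=
  ⟨fun hd₁ hd₂ hindex =>
      BergmanOrlicz.multipliers_eq_weightedHInfty h₁ h₂ hd₁ hd₂ hindex hα β,
    fun hmono ⟨_, hc, hω⟩ => BergmanOrlicz.multipliers_eq_hInfty h₁ h₂ hmono hα hc hω,
    fun hlim => BergmanOrlicz.multipliers_eq_singleton_zero h₁ h₂ hα hlim⟩

theorem theorem2p6 (Φ₁ Φ₂ : ℝ → ℝ) (α β : ℝ)
    (hΦ₁ : BergmanOrlicz.MemLU Φ₁) (hΦ₂ : BergmanOrlicz.MemLUTilde Φ₂)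
    (hmono : MonotoneOn (fun t => Φ₂ t / Φ₁ t) (Ioi 0))
    (hα : -1 < α) (hβ : -1 < β) :
    -- (i)
    (0 < BergmanOrlicz.lowerIndex Φ₁ →
      BergmanOrlicz.lowerIndex Φ₁ ≤ BergmanOrlicz.upperIndex Φ₁ →
      BergmanOrlicz.upperIndex Φ₁ < BergmanOrlicz.lowerIndex Φ₂ →
      BergmanOrlicz.lowerIndex Φ₂ ≤ BergmanOrlicz.upperIndex Φ₂ →
      BergmanOrlicz.upperIndex Φ₂ < ⊤ →
      BergmanOrlicz.multipliers Φ₁ α Φ₂ β =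
        BergmanOrlicz.weightedHInfty (BergmanOrlicz.multWeight Φ₁ α Φ₂ β)) ∧
    -- (ii)
    ((∃ c : ℝ, 0 < c ∧ ∀ t : ℝ, 0 < t →
        c⁻¹ ≤ BergmanOrlicz.multWeight Φ₁ α Φ₂ β t ∧
        BergmanOrlicz.multWeight Φ₁ α Φ₂ β t ≤ c) →
      BergmanOrlicz.multipliers Φ₁ α Φ₂ β = BergmanOrlicz.hInfty) ∧
    -- (iii)
    (Tendsto (BergmanOrlicz.multWeight Φ₁ α Φ₂ β) (𝓝[>] 0) (𝓝 0) →
      BergmanOrlicz.multipliers Φ₁ α Φ₂ β = {0}) := by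
  obtain ⟨hi, hii, hiii⟩ := theorem2p6_general Φ₁ Φ₂ α β hΦ₁.isModerateGrowth
    hΦ₂.memLU.isModerateGrowth hα
  exact ⟨fun _ _ hindex _ _ => hi hΦ₁.differentiableOn hΦ₂.memLU.differentiableOn hindex,
    hii hmono, hiii⟩
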